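/- Let $c>0$, $\beta\ge 0$, $\tau\ge 0$, let $q_u\ge 1$, $q_v\ge 0$ and $N\ge 1$ be integers, and let $\Omega=[x_L,x_R]$ with $x_L<x_R$ be regarded as a periodic domain with the uniform grid $x_j=x_L+jh$, $h=(x_R-x_L)/N$, $I_j=[x_j,x_{j+1}]$, element centers $\rho_j=(x_j+x_{j+1})/2$ and staggered elements $I_{j+1/2}=[\rho_j,\rho_{j+1}]$ (indices continued periodically). Let $U_h^{q_u-1}$ be the space of periodic functions that are polynomials of degree at most $q_u-1$ on each $I_j$, and $\widetilde V_h^{q_v}$ the space of periodic functions that are polynomials of degree at most $q_v$ on each $I_{j+1/2}$. Write $\phi^{\pm}(x)=\lim_{\varepsilon\to0^{\pm}}\phi(x+\varepsilon)$, and define the numerical fluxes $$H(v,w)=v-\beta c^2\,(w^--w^+),\qquad G(w,v)=w-\frac{\tau}{c^2}\,(v^--v^+).$$ The spatial operator $\mathcal L_c:U_h^{q_u-1}\times\widetilde V_h^{q_v}\to U_h^{q_u-1}\times\widetilde V_h^{q_v}$ of the staggered energy-based discontinuous Galerkin method for the wave equation $u_t=v$, $v_t=c^2u_{xx}$ (acting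 on $w=u_x$ and $v$) is the linear operator determined by $$\int_\Omega \mathcal L_c(cw,v)\cdot(c\varphi,\psi)\,dx=-c^2\sum_{j=0}^{N-1}\Big(\int_{x_j}^{x_{j+1}}\varphi_x v\,dx-\varphi^-H(v,w)\big|_{x_{j+1}}+\varphi^+H(v,w)\big|_{x_j}\Big)-c^2\sum_{j=0}^{N-1}\Big(\int_{\rho_j}^{\rho_{j+1}}\psi_x w\,dx-\psi^-G(w,v)\big|_{\rho_{j+1}}+\psi^+G(w,v)\big|_{\rho_j}\Big)$$ for all $w,\varphi\in U_h^{q_u-1}$ and $v,\psi\in\widetilde V_h^{q_v}$, with derivatives taken element by element. Its norm is $$\|\mathcal L_c\|=\sup\frac{\int_\Omega\mathcal L_c(cw,v)\cdot(c\varphi,\psi)\,dx}{\big(\|cw\|_{L^2(\Omega)}^2+\|v\|_{L^2(\Omega)}^2\big)^{1/2}\big(\|c\varphi\|_{L^2(\Omega)}^2+\|\psi\|_{L^2(\Omega)}^2\big)^{1/2}},$$ the supremum being over all $(w,v)\ne(0,0)$ and $(\varphi,\psi)\neq(0,0)$ in $U_h^{q_u-1}\times\widetilde V_h^{q_v}$.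 Then there are universal positive constants $C_3\le\frac{8\sqrt3+4}{3}$, $C_4\le\frac{128}{\sqrt3\,\pi}$ and $C_5\le4$, independent of $x_L,x_R,N,c,\beta,\tau,q_u,q_v$, such that the supremum is finite and $$\|\mathcal L_c\|\le\frac ch C_3\,(q_u+q_v-1)+\frac ch C_4\sqrt{q_u(q_v+1)}+\frac ch C_5\max\Big\{c\beta q_u^2,\ \frac{\tau}{c}(q_v+1)^2\Big\}.$$ In particular, $\|\mathcal L_c\|$ is bounded linearly in $q_u$ and $q_v$ in the following two cases: (i) if $\beta=\tau=0$, then $\|\mathcal L_c\|\le C\,\frac ch\,(q_u+q_v)$ with a universal constant $C$; (ii) if $\beta=\hat\beta/(q_uc)$ and $\tau=c\hat\tau/(q_v+1)$ with fixed constants $\hat\beta,\hat\tau\ge0$, then $\|\mathcal L_c\|\le C\,\frac ch\,(q_u+q_v)$ with a constant $C$ that depends only on $\hat\beta$ and $\hat\tau$. -/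

import Mathlib

open MeasureTheory Set Function Filter Topology

/-- A uniform grid with `N ≥ 1` elements on the interval `[xL, xR]`, which is regarded as a
periodic domain of period `xR - xL`. -/
structure UniformGrid where
  xL : ℝ
  xR : ℝ
  N : ℕ
  xL_lt_xR : xL < xR
  N_pos : 0 < N

namespace UniformGrid

/-- The length of the domain. -/
def period (g : UniformGrid) : ℝ := g.xR - g.xL

/-- The element width `h = (xR - xL) / N`. -/
noncomputable def h (g : UniformGrid) : ℝ := (g.xR - g.xL) / g.N

/-- The grid points `x_j = xL + j h`, periodically continued to all integers `j`.
The elements of the primal mesh are `I_j = [x_j, x_{j+1}]`. -/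
noncomputable def node (g : UniformGrid) (j : ℤ) : ℝ := g.xL + j * g.h

/-- The element centers `ρ_j = (x_j + x_{j+1}) / 2`.
The elements of the staggered mesh are `I_{j+1/2} = [ρ_j, ρ_{j+1}]`. -/
noncomputable def center (g : UniformGrid) (j : ℤ) : ℝ := (g.node j + g.node (j + 1)) / 2

/-- The broken polynomial space of degree `≤ d` on the mesh with elements `[e j, e (j+1)]`:
the periodic functions which on every element agree with a polynomial of degree at most `d`.
The value at a mesh point is normalized to be the limit from the right, so that two elements of
the space which agree almost everywhere are equal. -/
def broken (g : UniformGrid) (e : ℤ → ℝ) (d : ℕ) : Submodule ℝ (ℝ → ℝ) where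
  carrier := {w | Periodic w g.period ∧
    ∀ j : ℤ, ∃ p : Polynomial ℝ, p.natDegree ≤ d ∧ ∀ x ∈ Ico (e j) (e (j + 1)), w x = p.eval x}
  add_mem' := by
    rintro a b ⟨ha, ha'⟩ ⟨hb, hb'⟩
    refine ⟨ha.add hb, fun j => ?_⟩
    obtain ⟨p, hp, hp'⟩ := ha' j
    obtain ⟨q, hq, hq'⟩ := hb' j
    refine ⟨p + q, Polynomial.natDegree_add_le_of_degree_le hp hq, fun x hx => ?_⟩
    simp [hp' x hx, hq' x hx]
  zero_mem' := ⟨fun x => by simp, fun j => ⟨0, by simp, by simp⟩⟩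
  smul_mem' := by
    rintro r a ⟨ha, ha'⟩
    refine ⟨ha.smul r, fun j => ?_⟩
    obtain ⟨p, hp, hp'⟩ := ha' j
    refine ⟨r • p, (Polynomial.natDegree_smul_le r p).trans hp, fun x hx => ?_⟩
    simp [hp' x hx]

/-- `U_h^k`: broken polynomials of degree `≤ k` on the primal mesh. -/
noncomputable def U (g : UniformGrid) (k : ℕ) : Submodule ℝ (ℝ → ℝ) := g.broken g.node k

/-- `Ṽ_h^m`: broken polynomials of degree `≤ m` on the staggered mesh. -/
noncomputable def V (g : UniformGrid) (m : ℕ) : Submodule ℝ (ℝ → ℝ) := g.broken g.center m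

/-- The numerical flux `v* = H(v, w) = v - β c² (w⁻ - w⁺)` at the point `x`. -/
noncomputable def fluxH (c β : ℝ) (v w : ℝ → ℝ) (x : ℝ) : ℝ :=
  v x - β * c ^ 2 * (leftLim w x - rightLim w x)

/-- The numerical flux `w* = G(w, v) = w - (τ / c²) (v⁻ - v⁺)` at the point `x`. -/
noncomputable def fluxG (c τ : ℝ) (w v : ℝ → ℝ) (x : ℝ) : ℝ :=
  w x - τ / c ^ 2 * (leftLim v x - rightLim v x)

/-- The right-hand side of the staggered scheme, summed over the elements, with trial functions
`w ∈ U_h`, `v ∈ Ṽ_h` and test functions `φ ∈ U_h`, `ψ ∈ Ṽ_h`. Inside an element, `deriv` is the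
element by element derivative; the end points do not matter for the integrals. -/
noncomputable def form (g : UniformGrid) (c β τ : ℝ) (w v φ ψ : ℝ → ℝ) : ℝ :=
  - c ^ 2 * ∑ j ∈ Finset.range g.N,
      ((∫ x in g.node j..g.node (j + 1), deriv φ x * v x)
        - leftLim φ (g.node (j + 1)) * fluxH c β v w (g.node (j + 1))
        + rightLim φ (g.node j) * fluxH c β v w (g.node j))
  - c ^ 2 * ∑ j ∈ Finset.range g.N,
      ((∫ x in g.center j..g.center (j + 1), deriv ψ x * w x)
        - leftLim ψ (g.center (j + 1)) * fluxG c τ w v (g.center (j + 1))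
        + rightLim ψ (g.center j) * fluxG c τ w v (g.center j))

/-! ### Helper facts: linearity of the form, positivity of the `L²` product -/

theorem h_pos (g : UniformGrid) : 0 < g.h :=
  div_pos (sub_pos.2 g.xL_lt_xR) (Nat.cast_pos.2 g.N_pos)

theorem period_eq (g : UniformGrid) : g.period = g.N * g.h := by
  have : (g.N : ℝ) ≠ 0 := Nat.cast_ne_zero.2 g.N_pos.ne'
  unfold period h
  field_simp

theorem period_pos (g : UniformGrid) : 0 < g.period := sub_pos.2 g.xL_lt_xR

theorem node_eq (g : UniformGrid) (j : ℤ) : g.node j = g.node 0 + j * g.h := by simp [node]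

theorem center_eq (g : UniformGrid) (j : ℤ) : g.center j = g.center 0 + j * g.h := by
  simp [center, node]; ring

section helper

variable {g : UniformGrid} {e e' : ℤ → ℝ} {d d' : ℕ} {w v : ℝ → ℝ}

theorem mesh_lt (he : ∀ j, e j = e 0 + j * g.h) (j : ℤ) : e j < e (j + 1) := by
  rw [he j, he (j + 1)]; push_cast; nlinarith [g.h_pos]

theorem mesh_cover (he : ∀ j, e j = e 0 + j * g.h) (x : ℝ) :
    ∃ j : ℤ, x ∈ Ico (e j) (e (j + 1)) := by
  have hh := g.h_pos
  refine ⟨⌊(x - e 0) / g.h⌋, ?_, ?_⟩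
  · rw [he]
    have := Int.floor_le ((x - e 0) / g.h)
    rw [le_div_iff₀ hh] at this; linarith
  · rw [he]
    have := Int.lt_floor_add_one ((x - e 0) / g.h)
    rw [div_lt_iff₀ hh] at this; push_cast; linarith

theorem tendsto_left (he : ∀ j, e j = e 0 + j * g.h) (hw : w ∈ g.broken e d) (j : ℤ) :
    Tendsto w (𝓝[<] e j) (𝓝 (leftLim w (e j))) := by
  obtain ⟨p, -, hp⟩ := hw.2 (j - 1)
  have hlt := mesh_lt he (j - 1)
  rw [sub_add_cancel] at hp hlt
  have : Tendsto w (𝓝[<] e j) (𝓝 (p.eval (e j))) := by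
    refine Tendsto.congr' ?_ (p.continuous.continuousAt.tendsto.mono_left nhdsWithin_le_nhds)
    filter_upwards [Ico_mem_nhdsLT hlt] with x hx using (hp x hx).symm
  rwa [leftLim_eq_of_tendsto this]

theorem tendsto_right (he : ∀ j, e j = e 0 + j * g.h) (hw : w ∈ g.broken e d) (j : ℤ) :
    Tendsto w (𝓝[>] e j) (𝓝 (rightLim w (e j))) := by
  obtain ⟨p, -, hp⟩ := hw.2 j
  have : Tendsto w (𝓝[>] e j) (𝓝 (p.eval (e j))) := by
    refine Tendsto.congr' ?_ (p.continuous.continuousAt.tendsto.mono_left nhdsWithin_le_nhds)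
    filter_upwards [Ioo_mem_nhdsGT (mesh_lt he j)] with x hx using (hp x ⟨hx.1.le, hx.2⟩).symm
  rwa [rightLim_eq_of_tendsto this]

theorem leftLim_comb (he : ∀ j, e j = e 0 + j * g.h) (hw : w ∈ g.broken e d)
    (hv : v ∈ g.broken e d) (r : ℝ) (j : ℤ) :
    leftLim (r • w + v) (e j) = r * leftLim w (e j) + leftLim v (e j) :=
  leftLim_eq_of_tendsto
    (((tendsto_left he hw j).const_mul r).add (tendsto_left he hv j))

theorem rightLim_comb (he : ∀ j, e j = e 0 + j * g.h) (hw : w ∈ g.broken e d)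
    (hv : v ∈ g.broken e d) (r : ℝ) (j : ℤ) :
    rightLim (r • w + v) (e j) = r * rightLim w (e j) + rightLim v (e j) :=
  rightLim_eq_of_tendsto
    (((tendsto_right he hw j).const_mul r).add (tendsto_right he hv j))

theorem ae_on_element (he : ∀ j, e j = e 0 + j * g.h) {f q : ℝ → ℝ} (j : ℤ)
    (hf : ∀ x ∈ Ioo (e j) (e (j + 1)), f x = q x) :
    f =ᵐ[volume.restrict (uIoc (e j) (e (j + 1)))] q := by
  rw [uIoc_of_le (mesh_lt he j).le, ← restrict_Ioo_eq_restrict_Ioc]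
  filter_upwards [ae_restrict_mem measurableSet_Ioo] with x hx using hf x hx

theorem integrable_of_mem (he : ∀ j, e j = e 0 + j * g.h) (hw : w ∈ g.broken e d) (a b : ℝ) :
    IntervalIntegrable w volume a b := by
  have h1 : IntervalIntegrable w volume (e 0) (e 0 + g.period) := by
    have h2 := IntervalIntegrable.trans_iterate (f := w) (μ := volume) (n := g.N)
      (a := fun k : ℕ => e k) (fun k _ => by
        obtain ⟨p, -, hp⟩ := hw.2 k
        have h3 := ae_on_element he (k : ℤ) (f := w) (q := fun x => p.eval x)
          (fun x hx => hp x ⟨hx.1.le, hx.2⟩)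
        have h4 : IntervalIntegrable (fun x => p.eval x) volume (e k) (e (k + 1)) :=
          p.continuous.intervalIntegrable _ _
        exact_mod_cast h4.congr_ae h3.symm)
    simpa [he g.N, period_eq] using h2
  exact hw.1.intervalIntegrable g.period_pos.ne' h1 a b

theorem mul_mem_broken (hw : w ∈ g.broken e d) (hv : v ∈ g.broken e d') :
    w * v ∈ g.broken e (d + d') := by
  refine ⟨hw.1.mul hv.1, fun j => ?_⟩
  obtain ⟨p, hp, hp'⟩ := hw.2 j
  obtain ⟨q, hq, hq'⟩ := hv.2 j
  exact ⟨p * q, Polynomial.natDegree_mul_le.trans (add_le_add hp hq), fun x hx => by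
    simp [hp' x hx, hq' x hx]⟩

theorem deriv_on_element (hw : w ∈ g.broken e d) (j : ℤ) :
    ∃ p : Polynomial ℝ, ∀ x ∈ Ioo (e j) (e (j + 1)), HasDerivAt w (p.eval x) x := by
  obtain ⟨p, -, hp⟩ := hw.2 j
  refine ⟨p.derivative, fun x hx => (p.hasDerivAt x).congr_of_eventuallyEq ?_⟩
  filter_upwards [Ioo_mem_nhds hx.1 hx.2] with y hy using hp y ⟨hy.1.le, hy.2⟩

theorem integrable_deriv_mul (he : ∀ j, e j = e 0 + j * g.h) (he' : ∀ j, e' j = e' 0 + j * g.h)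
    (hw : w ∈ g.broken e d) (hv : v ∈ g.broken e' d') (j : ℤ) :
    IntervalIntegrable (fun x => deriv w x * v x) volume (e j) (e (j + 1)) := by
  obtain ⟨p, hp⟩ := deriv_on_element hw j
  have h1 : IntervalIntegrable (fun x => p.eval x * v x) volume (e j) (e (j + 1)) :=
    (integrable_of_mem he' hv _ _).continuousOn_mul p.continuous.continuousOn
  exact h1.congr_ae (ae_on_element he j fun x hx => by rw [(hp x hx).deriv])

theorem integral_comb_right (he : ∀ j, e j = e 0 + j * g.h)
    (he' : ∀ j, e' j = e' 0 + j * g.h) {φ : ℝ → ℝ} (hφ : φ ∈ g.broken e d)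
    (hw : w ∈ g.broken e' d') (hv : v ∈ g.broken e' d') (r : ℝ) (j : ℤ) :
    ∫ x in e j..e (j + 1), deriv φ x * (r • w + v) x =
      r * (∫ x in e j..e (j + 1), deriv φ x * w x) + ∫ x in e j..e (j + 1), deriv φ x * v x := by
  rw [← intervalIntegral.integral_const_mul, ← intervalIntegral.integral_add
    ((integrable_deriv_mul he he' hφ hw j).const_mul r) (integrable_deriv_mul he he' hφ hv j)]
  congr 1; ext x; simp; ring

theorem integral_comb_left (he : ∀ j, e j = e 0 + j * g.h)
    (he' : ∀ j, e' j = e' 0 + j * g.h) {φ ψ : ℝ → ℝ} (hφ : φ ∈ g.broken e d)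
    (hψ : ψ ∈ g.broken e d) (hv : v ∈ g.broken e' d') (r : ℝ) (j : ℤ) :
    ∫ x in e j..e (j + 1), deriv (r • φ + ψ) x * v x =
      r * (∫ x in e j..e (j + 1), deriv φ x * v x) + ∫ x in e j..e (j + 1), deriv ψ x * v x := by
  rw [← intervalIntegral.integral_const_mul, ← intervalIntegral.integral_add
    ((integrable_deriv_mul he he' hφ hv j).const_mul r) (integrable_deriv_mul he he' hψ hv j)]
  refine intervalIntegral.integral_congr_ae_restrict (ae_on_element he j fun x hx => ?_)
  obtain ⟨p, hp⟩ := deriv_on_element hφ j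
  obtain ⟨q, hq⟩ := deriv_on_element hψ j
  rw [(((hp x hx).const_smul r).add (hq x hx)).deriv, (hp x hx).deriv, (hq x hx).deriv]
  simp only [smul_eq_mul]; ring

theorem eq_zero_of_integral_sq (he : ∀ j, e j = e 0 + j * g.h) (hw : w ∈ g.broken e d)
    (h0 : ∫ x in g.xL..g.xR, w x * w x = 0) : w = 0 := by
  have hint := integrable_of_mem he (mul_mem_broken hw hw)
  have hper := (mul_mem_broken hw hw).1
  ext x
  obtain ⟨j, hj⟩ := mesh_cover he x
  obtain ⟨p, -, hp⟩ := hw.2 j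
  have hlt := mesh_lt he j
  have hle : e (j + 1) ≤ e j + g.period := by
    rw [he j, he (j + 1), period_eq]
    have : (1 : ℝ) ≤ g.N := by exact_mod_cast g.N_pos
    push_cast; nlinarith [g.h_pos]
  have h1 : ∫ x in e j..e j + g.period, (w * w) x = 0 := by
    rw [hper.intervalIntegral_add_eq (e j) g.xL]
    simpa [period] using h0
  have h2 : ∫ x in e j..e (j + 1), (w * w) x = 0 := by
    have h3 := intervalIntegral.integral_add_adjacent_intervals
      (hint (e j) (e (j + 1))) (hint (e (j + 1)) (e j + g.period))
    have h4 : 0 ≤ ∫ x in e j..e (j + 1), (w * w) x :=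
      intervalIntegral.integral_nonneg hlt.le fun x _ => mul_self_nonneg (w x)
    have h5 : 0 ≤ ∫ x in e (j + 1)..e j + g.period, (w * w) x :=
      intervalIntegral.integral_nonneg hle fun x _ => mul_self_nonneg (w x)
    linarith
  have h3 : ∫ x in e j..e (j + 1), (p * p).eval x = 0 := by
    rw [← h2]
    refine intervalIntegral.integral_congr_ae_restrict (ae_on_element he j fun y hy => ?_)
    simp [hp y ⟨hy.1.le, hy.2⟩]
  by_contra hne
  have h4 : 0 < ∫ x in e j..e (j + 1), (p * p).eval x := by
    refine intervalIntegral.integral_pos hlt (p * p).continuous.continuousOn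
      (fun y _ => by simpa using mul_self_nonneg (p.eval y)) ⟨x, ⟨hj.1, hj.2.le⟩, ?_⟩
    have : p.eval x ≠ 0 := by rw [← hp x hj]; exact hne
    simpa using mul_self_pos.2 this
  linarith

theorem finiteDimensional_broken (he : ∀ j, e j = e 0 + j * g.h) :
    FiniteDimensional ℝ (g.broken e d) := by
  let T : g.broken e d →ₗ[ℝ] (Fin g.N → Fin (d + 1) → ℝ) :=
    { toFun := fun w j i => (w : ℝ → ℝ) (e (j : ℕ) + (i : ℕ) / (d + 1) * g.h)
      map_add' := fun _ _ => rfl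
      map_smul' := fun _ _ => rfl }
  refine FiniteDimensional.of_injective T ((injective_iff_map_eq_zero T).2 ?_)
  rintro ⟨w, hw⟩ hT
  ext x
  change w x = 0
  obtain ⟨y, hy, hxy⟩ := hw.1.exists_mem_Ico g.period_pos x (e 0)
  rw [hxy]
  obtain ⟨j, hj⟩ := mesh_cover he y
  have hh := g.h_pos
  have hj0 : 0 ≤ j := by
    by_contra hneg
    have h1 : ((j + 1 : ℤ) : ℝ) ≤ 0 := by exact_mod_cast (by omega : j + 1 ≤ 0)
    have h2 := hj.2
    rw [he] at h2
    nlinarith [hy.1]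
  have hjN : j < g.N := by
    by_contra hneg
    have h1 : (g.N : ℝ) ≤ (j : ℝ) := by exact_mod_cast not_lt.1 hneg
    have h2 := hj.1
    have h3 := hy.2
    rw [he] at h2
    rw [period_eq] at h3
    nlinarith
  lift j to ℕ using hj0
  obtain ⟨p, hpd, hp⟩ := hw.2 j
  have hd : (0 : ℝ) < d + 1 := by positivity
  have hp0 : p = 0 := by
    refine Polynomial.eq_zero_of_natDegree_lt_card_of_eval_eq_zero p
      (f := fun i : Fin (d + 1) => e (j : ℤ) + ((i : ℕ) : ℝ) / (d + 1) * g.h) ?_ ?_ ?_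
    · intro a b hab
      have hab' : e (j : ℤ) + ((a : ℕ) : ℝ) / (d + 1) * g.h =
        e (j : ℤ) + ((b : ℕ) : ℝ) / (d + 1) * g.h := hab
      have h1 := mul_right_cancel₀ hh.ne' (add_left_cancel hab')
      rw [div_left_inj' hd.ne'] at h1
      exact Fin.ext (by exact_mod_cast h1)
    · intro i
      have hi : ((i : ℕ) : ℝ) / (d + 1) < 1 := by
        rw [div_lt_one hd]; exact_mod_cast i.2
      rw [← hp]
      · exact congrFun (congrFun hT ⟨j, by exact_mod_cast hjN⟩) i
      · constructor
        · have : 0 ≤ ((i : ℕ) : ℝ) / (d + 1) * g.h := by positivity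
          linarith
        · rw [he (j + 1), he j]; push_cast; nlinarith
    · simpa using Nat.lt_succ_of_le hpd
  rw [hp y hj, hp0]; simp

theorem form_comb_trial {k m : ℕ} {w' v' φ ψ : ℝ → ℝ} (c β τ r : ℝ) (hw : w ∈ g.U k)
    (hv : v ∈ g.V m) (hw' : w' ∈ g.U k) (hv' : v' ∈ g.V m) (hφ : φ ∈ g.U k) (hψ : ψ ∈ g.V m) :
    g.form c β τ (r • w + w') (r • v + v') φ ψ =
      r * g.form c β τ w v φ ψ + g.form c β τ w' v' φ ψ := by
  simp only [form, fluxH, fluxG, integral_comb_right g.node_eq g.center_eq hφ hv hv' r,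
    integral_comb_right g.center_eq g.node_eq hψ hw hw' r, leftLim_comb g.node_eq hw hw' r,
    rightLim_comb g.node_eq hw hw' r, leftLim_comb g.center_eq hv hv' r,
    rightLim_comb g.center_eq hv hv' r, mul_add r, mul_sub r, mul_left_comm r,
    Finset.mul_sum]
  simp only [← Finset.sum_sub_distrib, ← Finset.sum_add_distrib]
  refine Finset.sum_congr rfl fun j _ => ?_
  simp only [Pi.add_apply, Pi.smul_apply, smul_eq_mul]; ring

theorem form_comb_test {k m : ℕ} {φ ψ φ' ψ' : ℝ → ℝ} (c β τ r : ℝ) (hw : w ∈ g.U k)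
    (hv : v ∈ g.V m) (hφ : φ ∈ g.U k) (hψ : ψ ∈ g.V m) (hφ' : φ' ∈ g.U k) (hψ' : ψ' ∈ g.V m) :
    g.form c β τ w v (r • φ + φ') (r • ψ + ψ') =
      r * g.form c β τ w v φ ψ + g.form c β τ w v φ' ψ' := by
  simp only [form, integral_comb_left g.node_eq g.center_eq hφ hφ' hv r,
    integral_comb_left g.center_eq g.node_eq hψ hψ' hw r, leftLim_comb g.node_eq hφ hφ' r,
    rightLim_comb g.node_eq hφ hφ' r, leftLim_comb g.center_eq hψ hψ' r,
    rightLim_comb g.center_eq hψ hψ' r, mul_add r, mul_sub r, mul_left_comm r,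
    Finset.mul_sum]
  simp only [← Finset.sum_sub_distrib, ← Finset.sum_add_distrib]
  refine Finset.sum_congr rfl fun j _ => ?_
  ring

end helper

instance (g : UniformGrid) (k : ℕ) : FiniteDimensional ℝ (g.U k) :=
  finiteDimensional_broken g.node_eq

instance (g : UniformGrid) (m : ℕ) : FiniteDimensional ℝ (g.V m) :=
  finiteDimensional_broken g.center_eq

/-! ### The spatial operator and its norm -/

/-- A bilinear map from a function which is linear in each argument. -/
def bilin {E : Type*} [AddCommGroup E] [Module ℝ E] (B : E → E → ℝ)
    (h1 : ∀ (r : ℝ) a b z, B (r • a + b) z = r * B a z + B b z)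
    (h2 : ∀ (r : ℝ) a b z, B z (r • a + b) = r * B z a + B z b) : LinearMap.BilinForm ℝ E :=
  have e1 : ∀ z, B 0 z = 0 := fun z => by simpa using h1 1 0 0 z
  have e2 : ∀ z, B z 0 = 0 := fun z => by simpa using h2 1 0 0 z
  LinearMap.mk₂ ℝ B (fun a b z => by simpa using h1 1 a b z)
    (fun r a z => by simpa [e1] using h1 r a 0 z)
    (fun z a b => by simpa using h2 1 a b z)
    (fun r z a => by simpa [e2] using h2 r a 0 z)

/-- The `L²(Ω)` inner product `∫_Ω f₁ f₁' + f₂ f₂' dx` on `U_h^k × Ṽ_h^m`, as a bilinear form. -/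
noncomputable def ip (g : UniformGrid) (k m : ℕ) : LinearMap.BilinForm ℝ (g.U k × g.V m) :=
  bilin (fun f z => ∫ x in g.xL..g.xR,
      ((f.1 : ℝ → ℝ) x * (z.1 : ℝ → ℝ) x + (f.2 : ℝ → ℝ) x * (z.2 : ℝ → ℝ) x))
    (fun r a b z => by
      have i1 : ∀ p q : g.U k, IntervalIntegrable
          (fun x => (p : ℝ → ℝ) x * (q : ℝ → ℝ) x) volume g.xL g.xR := fun p q =>
        integrable_of_mem g.node_eq (mul_mem_broken p.2 q.2) g.xL g.xR
      have i2 : ∀ p q : g.V m, IntervalIntegrable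
          (fun x => (p : ℝ → ℝ) x * (q : ℝ → ℝ) x) volume g.xL g.xR := fun p q =>
        integrable_of_mem g.center_eq (mul_mem_broken p.2 q.2) g.xL g.xR
      rw [← intervalIntegral.integral_const_mul, ← intervalIntegral.integral_add
        (((i1 a.1 z.1).add (i2 a.2 z.2)).const_mul r) ((i1 b.1 z.1).add (i2 b.2 z.2))]
      congr 1; ext x; simp; ring)
    (fun r a b z => by
      have i1 : ∀ p q : g.U k, IntervalIntegrable
          (fun x => (p : ℝ → ℝ) x * (q : ℝ → ℝ) x) volume g.xL g.xR := fun p q =>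
        integrable_of_mem g.node_eq (mul_mem_broken p.2 q.2) g.xL g.xR
      have i2 : ∀ p q : g.V m, IntervalIntegrable
          (fun x => (p : ℝ → ℝ) x * (q : ℝ → ℝ) x) volume g.xL g.xR := fun p q =>
        integrable_of_mem g.center_eq (mul_mem_broken p.2 q.2) g.xL g.xR
      rw [← intervalIntegral.integral_const_mul, ← intervalIntegral.integral_add
        (((i1 z.1 a.1).add (i2 z.2 a.2)).const_mul r) ((i1 z.1 b.1).add (i2 z.2 b.2))]
      congr 1; ext x; simp; ring)

theorem ip_apply (g : UniformGrid) (k m : ℕ) (f z : g.U k × g.V m) :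
    g.ip k m f z = ∫ x in g.xL..g.xR,
      ((f.1 : ℝ → ℝ) x * (z.1 : ℝ → ℝ) x + (f.2 : ℝ → ℝ) x * (z.2 : ℝ → ℝ) x) := rfl

theorem ip_self_eq_zero (g : UniformGrid) (k m : ℕ) (f : g.U k × g.V m)
    (hf : g.ip k m f f = 0) : f = 0 := by
  have i1 := integrable_of_mem g.node_eq (mul_mem_broken f.1.2 f.1.2) g.xL g.xR
  have i2 := integrable_of_mem g.center_eq (mul_mem_broken f.2.2 f.2.2) g.xL g.xR
  have h1 : 0 ≤ ∫ x in g.xL..g.xR, (f.1 : ℝ → ℝ) x * (f.1 : ℝ → ℝ) x :=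
    intervalIntegral.integral_nonneg g.xL_lt_xR.le fun x _ => mul_self_nonneg _
  have h2 : 0 ≤ ∫ x in g.xL..g.xR, (f.2 : ℝ → ℝ) x * (f.2 : ℝ → ℝ) x :=
    intervalIntegral.integral_nonneg g.xL_lt_xR.le fun x _ => mul_self_nonneg _
  have h3 := intervalIntegral.integral_add i1 i2
  have h4 : (∫ x in g.xL..g.xR, (f.1 : ℝ → ℝ) x * (f.1 : ℝ → ℝ) x) +
      ∫ x in g.xL..g.xR, (f.2 : ℝ → ℝ) x * (f.2 : ℝ → ℝ) x = 0 := h3.symm.trans hf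
  refine Prod.ext (Subtype.ext ?_) (Subtype.ext ?_)
  · exact eq_zero_of_integral_sq g.node_eq f.1.2 (by linarith)
  · exact eq_zero_of_integral_sq g.center_eq f.2.2 (by linarith)

theorem ip_nondegenerate (g : UniformGrid) (k m : ℕ) : (g.ip k m).Nondegenerate :=
  ⟨fun f hf => g.ip_self_eq_zero k m f (hf f), fun f hf => g.ip_self_eq_zero k m f (hf f)⟩

/-- The form as a bilinear form on `U_h^k × Ṽ_h^m`. -/
noncomputable def formB (g : UniformGrid) (c β τ : ℝ) (k m : ℕ) :
    LinearMap.BilinForm ℝ (g.U k × g.V m) :=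
  bilin (fun f z => g.form c β τ f.1 f.2 z.1 z.2)
    (fun r a b z => form_comb_trial c β τ r a.1.2 a.2.2 b.1.2 b.2.2 z.1.2 z.2.2)
    (fun r a b z => form_comb_test c β τ r z.1.2 z.2.2 a.1.2 a.2.2 b.1.2 b.2.2)

/-- The map `(w, v) ↦ (a w, v)`. -/
noncomputable def scale (g : UniformGrid) (k m : ℕ) (a : ℝ) :
    (g.U k × g.V m) →ₗ[ℝ] (g.U k × g.V m) :=
  (a • LinearMap.id).prodMap LinearMap.id

/-- The spatial operator `L_c : U_h^k × Ṽ_h^m → U_h^k × Ṽ_h^m`: the Riesz representation of the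
form, so that `∫_Ω L_c(c w, v) · (c φ, ψ) dx` equals the form at `(w, v)`, `(φ, ψ)`
(see `spatialOp_spec`). -/
noncomputable def spatialOp (g : UniformGrid) (c β τ : ℝ) (k m : ℕ) :
    (g.U k × g.V m) →ₗ[ℝ] (g.U k × g.V m) :=
  ((g.ip k m).toDual (g.ip_nondegenerate k m)).symm.toLinearMap ∘ₗ
    (g.formB c β τ k m).compl₁₂ (g.scale k m c⁻¹) (g.scale k m c⁻¹)

/-- The defining identity of the spatial operator. -/
theorem spatialOp_spec (g : UniformGrid) {c : ℝ} (hc : c ≠ 0) (β τ : ℝ) (k m : ℕ)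
    (w φ : g.U k) (v ψ : g.V m) :
    g.ip k m (g.spatialOp c β τ k m (c • w, v)) (c • φ, ψ) = g.form c β τ w v φ ψ := by
  have h1 : ∀ (a : g.U k) (b : g.V m), g.scale k m c⁻¹ (c • a, b) = (a, b) := fun a b => by
    simp [scale, smul_smul, hc]
  simp only [spatialOp, LinearMap.comp_apply, LinearEquiv.coe_coe,
    LinearMap.BilinForm.apply_toDual_symm_apply, LinearMap.compl₁₂_apply, h1]
  rfl

/-- The quotients in the definition of the operator norm: all
`∫_Ω L(c w, v) · (c φ, ψ) dx` divided by
`(‖c w‖² + ‖v‖²)^(1/2) (‖c φ‖² + ‖ψ‖²)^(1/2)` with `(w, v) ≠ 0` and `(φ, ψ) ≠ 0`. -/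
noncomputable def quotients (g : UniformGrid) (c : ℝ) (k m : ℕ)
    (L : (g.U k × g.V m) →ₗ[ℝ] (g.U k × g.V m)) : Set ℝ :=
  {r | ∃ (w φ : g.U k) (v ψ : g.V m), (w, v) ≠ (0, 0) ∧ (φ, ψ) ≠ (0, 0) ∧
    r = g.ip k m (L (c • w, v)) (c • φ, ψ) /
      (√(g.ip k m (c • w, v) (c • w, v)) * √(g.ip k m (c • φ, ψ) (c • φ, ψ)))}

/-- The operator norm, as the supremum of the quotients. -/
noncomputable def opNorm (g : UniformGrid) (c : ℝ) (k m : ℕ)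
    (L : (g.U k × g.V m) →ₗ[ℝ] (g.U k × g.V m)) : ℝ :=
  sSup (g.quotients c k m L)

end UniformGrid

/-! An inverse or trace inequality on a whole element costs the square of the degree, but only
because of the ends of the element. By Legendre expansion, `∫ (x-a)(b-x) p'² ≤ k(k+1) ∫ p²` for
degree `k` (`integralOn_weighted_derivative_sq_le`). On the middle half of the element the weight is
comparable to `h²`, so there `p'` costs only one factor of order `k/h` in `L²`
(`integralOn_derivative_sq_middle_le`), and a point value squared costs order `k/h`
(`sq_eval_quarter_le`).

On a staggered pair of meshes, every quarter of an element lies in the middle half of its primal or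
of its dual element. In `∫ φ' v` the derivative stays on `φ` in the two inner quarters and is moved
to `v` by parts in the two outer ones. The boundary terms at the element ends cancel the central
part of the flux, because `v` is smooth there; only values at the quarter points remain, where both
functions have the cheap point bound. This gives the linear terms and the square root
(`abs_staggered_pairing_le`).

The penalty terms involve one-sided values at the element ends. They need the sharp trace
inequality, quadratic in the degree (`sq_eval_endpoint_le`), which accounts for the maximum. Both
halves of the form are instances of one estimate (`abs_halfForm_le`), with the roles of the meshes
exchanged. All products are bounded by sums of squares, so cell estimates add up to `K/2 (‖f‖² +
‖z‖²)`; scaling `f` and `z` to norm one then gives the operator bound `K`. -/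

namespace Polynomial

/-! ### Integration of polynomials and orthogonal projection. -/

/-- Integration over `[a, b]` as a linear functional on polynomials. -/
noncomputable def integralOn (a b : ℝ) : ℝ[X] →ₗ[ℝ] ℝ where
  toFun p := ∫ x in a..b, p.eval x
  map_add' p q := by
    simp only [eval_add]
    exact intervalIntegral.integral_add (p.continuous.intervalIntegrable _ _)
      (q.continuous.intervalIntegrable _ _)
  map_smul' r p := by simp

theorem integralOn_C_mul (a b r : ℝ) (p : ℝ[X]) :
    integralOn a b (C r * p) = r * integralOn a b p := by
  rw [← smul_eq_C_mul, map_smul, smul_eq_mul]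

theorem integralOn_derivative (a b : ℝ) (p : ℝ[X]) :
    integralOn a b (derivative p) = p.eval b - p.eval a :=
  intervalIntegral.integral_eq_sub_of_hasDerivAt (fun x _ => p.hasDerivAt x)
    ((derivative p).continuous.intervalIntegrable _ _)

theorem integralOn_mono {a b : ℝ} (hab : a ≤ b) {p q : ℝ[X]}
    (h : ∀ x ∈ Icc a b, p.eval x ≤ q.eval x) : integralOn a b p ≤ integralOn a b q :=
  intervalIntegral.integral_mono_on hab (p.continuous.intervalIntegrable _ _)
    (q.continuous.intervalIntegrable _ _) h

theorem integralOn_nonneg {a b : ℝ} (hab : a ≤ b) {p : ℝ[X]}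
    (h : ∀ x ∈ Icc a b, 0 ≤ p.eval x) : 0 ≤ integralOn a b p :=
  intervalIntegral.integral_nonneg hab h

theorem integralOn_add_adjacent (a b c : ℝ) (p : ℝ[X]) :
    integralOn a b p + integralOn b c p = integralOn a c p :=
  intervalIntegral.integral_add_adjacent_intervals (p.continuous.intervalIntegrable _ _)
    (p.continuous.intervalIntegrable _ _)

theorem integralOn_subset {a b s t : ℝ} (has : a ≤ s) (hst : s ≤ t) (htb : t ≤ b) {p : ℝ[X]}
    (h : ∀ x ∈ Icc a b, 0 ≤ p.eval x) : integralOn s t p ≤ integralOn a b p := by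
  rw [← integralOn_add_adjacent a s b, ← integralOn_add_adjacent s t b]
  have h1 : 0 ≤ integralOn a s p :=
    integralOn_nonneg has fun x hx => h x ⟨hx.1, by linarith [hx.2]⟩
  have h2 : 0 ≤ integralOn t b p :=
    integralOn_nonneg htb fun x hx => h x ⟨by linarith [hx.1], hx.2⟩
  linarith

theorem integralOn_mul_self_nonneg {a b : ℝ} (hab : a ≤ b) (p : ℝ[X]) :
    0 ≤ integralOn a b (p * p) :=
  integralOn_nonneg hab fun x _ => by rw [eval_mul]; exact mul_self_nonneg _

theorem eq_zero_of_integralOn_mul_self {a b : ℝ} (hab : a < b) {p : ℝ[X]}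
    (h : integralOn a b (p * p) = 0) : p = 0 := by
  by_contra hp
  obtain ⟨x, hx, hx0⟩ : ∃ x ∈ Icc a b, p.eval x ≠ 0 := by
    by_contra! hall
    exact hp (p.eq_zero_of_infinite_isRoot ((Icc_infinite hab).mono fun x hx => hall x hx))
  have : 0 < integralOn a b (p * p) :=
    intervalIntegral.integral_pos hab (p * p).continuous.continuousOn
      (fun y _ => by simpa using mul_self_nonneg (p.eval y))
      ⟨x, hx, by simpa using mul_self_pos.2 hx0⟩
  exact this.ne' h

/-- Orthogonal projection onto the polynomials of degree `< n` in `L²(a, b)`. -/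
theorem exists_orthogonal_projection {a b : ℝ} (hab : a < b) (n : ℕ) (p : ℝ[X]) :
    ∃ r ∈ degreeLT ℝ n, ∀ s ∈ degreeLT ℝ n, integralOn a b ((p - r) * s) = 0 := by
  let B : LinearMap.BilinForm ℝ ℝ[X] := (LinearMap.mul ℝ ℝ[X]).compr₂ (integralOn a b)
  let B' : LinearMap.BilinForm ℝ (degreeLT ℝ n) := B.restrict (degreeLT ℝ n)
  have hB : ∀ x : degreeLT ℝ n, B' x x = 0 → x = 0 := fun x hx =>
    Subtype.ext (eq_zero_of_integralOn_mul_self hab hx)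
  have hnd : B'.Nondegenerate := ⟨fun x hx => hB x (hx x), fun x hx => hB x (hx x)⟩
  have : FiniteDimensional ℝ (degreeLT ℝ n) :=
    Module.Finite.equiv (degreeLTEquiv ℝ n).symm
  refine ⟨(B'.toDual hnd).symm ((B p).comp (degreeLT ℝ n).subtype), Subtype.coe_prop _,
    fun s hs => ?_⟩
  have h := LinearMap.BilinForm.apply_toDual_symm_apply (hB := hnd)
    ((B p).comp (degreeLT ℝ n).subtype) ⟨s, hs⟩
  rw [sub_mul, map_sub, sub_eq_zero]
  exact h.symm

/-! ### The Legendre operator and the weighted Bernstein inequality. -/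

theorem mem_degreeLT_iff_coeff {n : ℕ} {p : ℝ[X]} :
    p ∈ degreeLT ℝ n ↔ ∀ i, n ≤ i → p.coeff i = 0 := by
  rw [mem_degreeLT, degree_lt_iff_coeff_zero]

theorem coeff_X_mul_derivative (p : ℝ[X]) (n : ℕ) :
    (X * derivative p).coeff n = n * p.coeff n := by
  cases n with
  | zero => simp
  | succ n => rw [coeff_X_mul, coeff_derivative]; push_cast; ring

/-- The Legendre differential operator of the interval `[a, b]`. -/
noncomputable def legendreOp (a b : ℝ) (p : ℝ[X]) : ℝ[X] :=
  derivative ((X - C a) * (C b - X) * derivative p)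

/-- The operator is triangular with respect to degree, with diagonal entry `-k(k+1)`. An `l` of
degree at most `k` orthogonal to lower degrees thus behaves like an eigenfunction when tested
against itself. -/
theorem legendreOp_add_smul_mem (a b : ℝ) {k : ℕ} {p : ℝ[X]} (hp : p ∈ degreeLT ℝ (k + 1)) :
    legendreOp a b p + C ((k : ℝ) * (k + 1)) * p ∈ degreeLT ℝ k := by
  rw [mem_degreeLT_iff_coeff] at hp ⊢
  intro i hi
  -- In terms of the Euler operator `X d/dx`, which multiplies the `i`-th coefficient by `i`, only
  -- the first two terms keep the degree; they contribute `-i - i²`.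
  have h1 : legendreOp a b p = -(X * derivative p) - X * derivative (X * derivative p)
      + C (a + b) * derivative (X * derivative p) - C (a * b) * derivative (derivative p) := by
    simp only [legendreOp, derivative_mul, derivative_sub, derivative_X, derivative_C, C_add,
      C_mul]
    ring
  have h2 : p.coeff (i + 1) = 0 := hp _ (by omega)
  have h3 : p.coeff (i + 1 + 1) = 0 := hp _ (by omega)
  rw [h1]
  simp only [coeff_add, coeff_sub, coeff_neg, coeff_C_mul, coeff_X_mul_derivative,
    coeff_derivative, h2, h3]
  rcases hi.eq_or_lt with rfl | hlt
  · ring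
  · rw [hp i hlt]; ring

theorem legendreOp_mem (a b : ℝ) {k : ℕ} {p : ℝ[X]} (hp : p ∈ degreeLT ℝ k) :
    legendreOp a b p ∈ degreeLT ℝ k := by
  cases k with
  | zero =>
    have : p = 0 := by ext i; exact mem_degreeLT_iff_coeff.1 hp i i.zero_le
    simp [this, legendreOp]
  | succ k =>
    have h1 := degreeLT_mono k.le_succ (legendreOp_add_smul_mem a b hp)
    rw [← smul_eq_C_mul] at h1
    exact ((degreeLT ℝ (k + 1)).add_mem_iff_left (Submodule.smul_mem _ _ hp)).1 h1

theorem X_sub_C_mul_derivative_sub_mem (e : ℝ) {k : ℕ} {p : ℝ[X]} (hp : p ∈ degreeLT ℝ (k + 1)) :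
    (X - C e) * derivative p - C (k : ℝ) * p ∈ degreeLT ℝ k := by
  rw [mem_degreeLT_iff_coeff] at hp ⊢
  intro i hi
  rw [sub_mul]
  simp only [coeff_sub, coeff_C_mul, coeff_X_mul_derivative, coeff_derivative,
    hp (i + 1) (by omega)]
  rcases hi.eq_or_lt with rfl | hlt
  · ring
  · rw [hp i hlt]; ring

/-- Integration by parts; the weight vanishes at both end points. -/
theorem integralOn_legendreOp_mul (a b : ℝ) (p q : ℝ[X]) :
    integralOn a b (legendreOp a b p * q) =
      -integralOn a b ((X - C a) * (C b - X) * (derivative p * derivative q)) := by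
  have h := integralOn_derivative a b ((X - C a) * (C b - X) * derivative p * q)
  rw [derivative_mul, map_add] at h
  simp only [eval_mul, eval_sub, eval_X, eval_C, sub_self, zero_mul, mul_zero] at h
  rw [mul_assoc _ (derivative p)] at h
  unfold legendreOp
  linarith

/-- The weighted Bernstein inequality in `L²`. -/
theorem integralOn_weighted_derivative_sq_le {a b : ℝ} (hab : a < b) (n : ℕ) :
    ∀ p ∈ degreeLT ℝ n,
      integralOn a b ((X - C a) * (C b - X) * (derivative p * derivative p)) ≤
        (n : ℝ) * (n - 1) * integralOn a b (p * p) := by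
  induction n with
  | zero =>
    intro p hp
    have : p = 0 := by ext i; exact mem_degreeLT_iff_coeff.1 hp i i.zero_le
    simp [this]
  | succ k ih =>
    intro p hp
    obtain ⟨r, hr, horth⟩ := exists_orthogonal_projection hab k p
    obtain ⟨l, rfl⟩ : ∃ l, p = l + r := ⟨p - r, by ring⟩
    rw [add_sub_cancel_right] at horth
    have hl : l ∈ degreeLT ℝ (k + 1) :=
      ((degreeLT ℝ (k + 1)).add_mem_iff_left (degreeLT_mono k.le_succ hr)).1 hp
    have h1 := horth _ hr
    have h2 := horth _ (legendreOp_mem a b hr)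
    have h3 := horth _ (legendreOp_add_smul_mem a b hl)
    -- `h2` kills the weighted cross term of `l'` and `r'`; `h3` becomes an equality with constant
    -- `k(k+1)` for the top component `l`. The lower part `r` has the smaller constant `k(k-1)` by
    -- induction.
    rw [mul_comm, integralOn_legendreOp_mul] at h2
    rw [mul_add, map_add, mul_comm l, integralOn_legendreOp_mul, mul_left_comm l (C _),
      integralOn_C_mul] at h3
    have h4 := ih r hr
    have e1 : integralOn a b ((l + r) * (l + r)) =
        integralOn a b (l * l) + integralOn a b (r * r) := by
      rw [show (l + r) * (l + r) = l * l + r * r + (l * r + l * r) by ring]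
      simp only [map_add, h1]; ring
    have e2 : integralOn a b
          ((X - C a) * (C b - X) * (derivative (l + r) * derivative (l + r))) =
        integralOn a b ((X - C a) * (C b - X) * (derivative l * derivative l)) +
          integralOn a b ((X - C a) * (C b - X) * (derivative r * derivative r)) := by
      rw [show (X - C a) * (C b - X) * (derivative (l + r) * derivative (l + r)) =
        (X - C a) * (C b - X) * (derivative l * derivative l) +
        (X - C a) * (C b - X) * (derivative r * derivative r) +
        ((X - C a) * (C b - X) * (derivative r * derivative l) +
          (X - C a) * (C b - X) * (derivative r * derivative l)) by rw [derivative_add]; ring]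
      simp only [map_add]; linarith
    have h5 := integralOn_mul_self_nonneg hab.le r
    rw [e1, e2]
    push_cast
    nlinarith [mul_nonneg (Nat.cast_nonneg (α := ℝ) k) h5]

/-! ### Trace inequality and estimates on the middle half. -/

/-- Cauchy–Schwarz with `(2κ + 1) + κ² = (κ + 1)²`: this adds the top Legendre component `x` to the
lower-degree remainder `y` in the induction for the trace inequality. -/
theorem sq_add_mul_le_of_sq_mul_le {x y h A B κ : ℝ} (hh : 0 < h) (hB : 0 ≤ B)
    (hκ : 0 ≤ κ) (hx : h * x ^ 2 = (2 * κ + 1) * A) (hy : h * y ^ 2 ≤ κ ^ 2 * B) :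
    h * (x + y) ^ 2 ≤ (κ + 1) ^ 2 * (A + B) := by
  have hA : 0 ≤ A := by
    have : 0 ≤ (2 * κ + 1) * A := by rw [← hx]; positivity
    exact nonneg_of_mul_nonneg_right this (by positivity)
  have h1 : (h * (2 * x * y)) ^ 2 ≤ (κ ^ 2 * A + (2 * κ + 1) * B) ^ 2 := by
    calc (h * (2 * x * y)) ^ 2 = 4 * (h * x ^ 2) * (h * y ^ 2) := by ring
      _ ≤ 4 * ((2 * κ + 1) * A) * (κ ^ 2 * B) := by rw [hx]; gcongr
      _ ≤ _ := by nlinarith [sq_nonneg (κ ^ 2 * A - (2 * κ + 1) * B)]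
  have h2 := abs_le_of_sq_le_sq' h1 (by positivity)
  nlinarith [h2.2]

/-- The sharp trace inequality at an end point `e` of the interval, `o` being the other one. -/
theorem sq_eval_endpoint_le {a b e o : ℝ} (hab : a < b)
    (heo : (e = b ∧ o = a) ∨ (e = a ∧ o = b)) (n : ℕ) :
    ∀ p ∈ degreeLT ℝ n,
      (b - a) * (p.eval e) ^ 2 ≤ (n : ℝ) ^ 2 * integralOn a b (p * p) := by
  induction n with
  | zero =>
    intro p hp
    have : p = 0 := by ext i; exact mem_degreeLT_iff_coeff.1 hp i i.zero_le
    simp [this]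
  | succ k ih =>
    intro p hp
    obtain ⟨r, hr, horth⟩ := exists_orthogonal_projection hab k p
    obtain ⟨l, rfl⟩ : ∃ l, p = l + r := ⟨p - r, by ring⟩
    rw [add_sub_cancel_right] at horth
    have hl : l ∈ degreeLT ℝ (k + 1) :=
      ((degreeLT ℝ (k + 1)).add_mem_iff_left (degreeLT_mono k.le_succ hr)).1 hp
    have h1 := horth _ hr
    have h3 := horth _ (X_sub_C_mul_derivative_sub_mem o hl)
    rw [mul_sub, map_sub, mul_left_comm l (C _), integralOn_C_mul] at h3
    have e1 : integralOn a b ((l + r) * (l + r)) =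
        integralOn a b (l * l) + integralOn a b (r * r) := by
      rw [show (l + r) * (l + r) = l * l + r * r + (l * r + l * r) by ring]
      simp only [map_add, h1]; ring
    -- The factor `X - o` removes the boundary term at `o`. By `h3` the integral of `l (X - o) l'`
    -- is `k ∫ l²`, so the total is `(2k + 1) ∫ l²`.
    have h4 := integralOn_derivative a b ((X - C o) * (l * l))
    have h5 : derivative ((X - C o) * (l * l)) =
        l * l + (l * ((X - C o) * derivative l) + l * ((X - C o) * derivative l)) := by
      simp only [derivative_mul, derivative_sub, derivative_X, derivative_C]; ring
    rw [h5, map_add, map_add] at h4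
    simp only [eval_mul, eval_sub, eval_X, eval_C] at h4
    have h6 : (b - a) * (l.eval e) ^ 2 = (2 * (k : ℝ) + 1) * integralOn a b (l * l) := by
      rcases heo with ⟨rfl, rfl⟩ | ⟨rfl, rfl⟩ <;> linarith
    rw [e1, eval_add]
    push_cast
    exact sq_add_mul_le_of_sq_mul_le (sub_pos.2 hab) (integralOn_mul_self_nonneg hab.le r)
      k.cast_nonneg h6 (ih r hr)

theorem mem_degreeLT_succ_of_natDegree_le {p : ℝ[X]} {k : ℕ} (hp : p.natDegree ≤ k) :
    p ∈ degreeLT ℝ (k + 1) :=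
  mem_degreeLT_iff_coeff.2 fun _ hi => coeff_eq_zero_of_natDegree_lt (by omega)

theorem sq_eval_right_le {a b : ℝ} (hab : a < b) {k : ℕ} {p : ℝ[X]} (hp : p.natDegree ≤ k) :
    (p.eval b) ^ 2 ≤ ((k : ℝ) + 1) ^ 2 / (b - a) * integralOn a b (p * p) := by
  have h := sq_eval_endpoint_le hab (Or.inl ⟨rfl, rfl⟩) _ p (mem_degreeLT_succ_of_natDegree_le hp)
  rw [div_mul_eq_mul_div, le_div_iff₀ (sub_pos.2 hab)]
  push_cast at h
  linarith

theorem sq_eval_left_le {a b : ℝ} (hab : a < b) {k : ℕ} {p : ℝ[X]} (hp : p.natDegree ≤ k) :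
    (p.eval a) ^ 2 ≤ ((k : ℝ) + 1) ^ 2 / (b - a) * integralOn a b (p * p) := by
  have h := sq_eval_endpoint_le hab (Or.inr ⟨rfl, rfl⟩) _ p (mem_degreeLT_succ_of_natDegree_le hp)
  rw [div_mul_eq_mul_div, le_div_iff₀ (sub_pos.2 hab)]
  push_cast at h
  linarith

/-- The inverse inequality on the middle half of the interval. -/
theorem integralOn_derivative_sq_middle_le {a h s t : ℝ} (hh : 0 < h) {k : ℕ} {p : ℝ[X]}
    (hp : p.natDegree ≤ k) (hs : a + h / 4 ≤ s) (hst : s ≤ t) (ht : t ≤ a + 3 * h / 4) :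
    integralOn s t (derivative p * derivative p) ≤
      16 / 3 * ((k : ℝ) * (k + 1)) / h ^ 2 * integralOn a (a + h) (p * p) := by
  have h1 := integralOn_weighted_derivative_sq_le (lt_add_of_pos_right a hh) _ p
    (mem_degreeLT_succ_of_natDegree_le hp)
  -- On the middle half the weight is at least `(h/4)(3h/4) = 3h²/16`.
  have h2 : integralOn s t (C (3 * h ^ 2 / 16) * (derivative p * derivative p)) ≤
      integralOn s t ((X - C a) * (C (a + h) - X) * (derivative p * derivative p)) := by
    refine integralOn_mono hst fun x hx => ?_
    simp only [eval_mul, eval_sub, eval_X, eval_C]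
    refine mul_le_mul_of_nonneg_right ?_ (mul_self_nonneg _)
    nlinarith [mul_nonneg (sub_nonneg.2 (hs.trans hx.1)) (sub_nonneg.2 (hx.2.trans ht))]
  have h3 : integralOn s t ((X - C a) * (C (a + h) - X) * (derivative p * derivative p)) ≤
      integralOn a (a + h) ((X - C a) * (C (a + h) - X) * (derivative p * derivative p)) := by
    refine integralOn_subset (by linarith) hst (by linarith) fun x hx => ?_
    simp only [eval_mul, eval_sub, eval_X, eval_C]
    exact mul_nonneg (mul_nonneg (sub_nonneg.2 hx.1) (sub_nonneg.2 hx.2)) (mul_self_nonneg _)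
  rw [integralOn_C_mul] at h2
  push_cast at h1
  rw [div_mul_eq_mul_div, le_div_iff₀ (by positivity)]
  linarith

/-- Polynomials at the ends of the middle half of the interval. -/
theorem sq_eval_quarter_le {a h z : ℝ} (hh : 0 < h) {k : ℕ} {p : ℝ[X]} (hp : p.natDegree ≤ k)
    (hz : z = a + h / 4 ∨ z = a + 3 * h / 4) :
    (p.eval z) ^ 2 ≤ 8 * ((k : ℝ) + 1) / h * integralOn a (a + h) (p * p) := by
  set s := a + h / 4 with hs
  set t := a + 3 * h / 4 with ht
  -- `o` is the opposite quarter point: `(x - o) p²` vanishes there, so its derivative integrates to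
  -- `(h/2) p(z)²`.
  obtain ⟨o, ho⟩ : ∃ o, (z = s ∧ o = t) ∨ (z = t ∧ o = s) := by
    rcases hz with hz | hz
    · exact ⟨t, Or.inl ⟨hz, rfl⟩⟩
    · exact ⟨s, Or.inr ⟨hz, rfl⟩⟩
  have hst : s ≤ t := by rw [hs, ht]; linarith
  have hk : (0 : ℝ) < k + 1 := by positivity
  have h1 := integralOn_derivative s t ((X - C o) * (p * p))
  have h2 : (h / 2) * (p.eval z) ^ 2 = integralOn s t (derivative ((X - C o) * (p * p))) := by
    rw [h1]
    simp only [eval_mul, eval_sub, eval_X, eval_C]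
    rcases ho with ⟨rfl, rfl⟩ | ⟨rfl, rfl⟩ <;> rw [hs, ht] <;> ring
  -- Young's inequality with weight `k + 1`, which balances the two terms: after the derivative
  -- bound they are `(k + 2) ∫ p²` and `(4k/3) ∫ p²`, together at most `4(k + 1) ∫ p²`.
  have h3 : integralOn s t (derivative ((X - C o) * (p * p))) ≤
      integralOn s t (C ((k : ℝ) + 2) * (p * p)
        + C (h ^ 2 / (4 * (k + 1))) * (derivative p * derivative p)) := by
    refine integralOn_mono hst fun x hx => ?_
    simp only [derivative_mul, derivative_sub, derivative_X, derivative_C, eval_mul, eval_add,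
      eval_sub, eval_X, eval_C, eval_one, eval_zero]
    have h4 : (x - o) ^ 2 ≤ (h / 2) ^ 2 := by
      rcases ho with ⟨-, rfl⟩ | ⟨-, rfl⟩ <;> rw [hs, ht] at * <;>
        nlinarith [hx.1, hx.2]
    have h5 : h ^ 2 / (4 * (k + 1)) * ((derivative p).eval x * (derivative p).eval x) ≥
        ((x - o) * (derivative p).eval x) ^ 2 / (k + 1) := by
      rw [mul_pow, ge_iff_le, div_mul_eq_mul_div, div_le_div_iff₀ hk (by positivity)]
      nlinarith [mul_le_mul_of_nonneg_right h4
        (mul_nonneg (sq_nonneg ((derivative p).eval x)) hk.le)]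
    have h6 : 2 * (p.eval x) * ((x - o) * (derivative p).eval x) ≤
        (k + 1) * (p.eval x) ^ 2 + ((x - o) * (derivative p).eval x) ^ 2 / (k + 1) := by
      have h7 := sq_nonneg ((k + 1) * p.eval x - (x - o) * (derivative p).eval x)
      have h8 : (k + 1 : ℝ) * (((x - o) * (derivative p).eval x) ^ 2 / (k + 1)) =
        ((x - o) * (derivative p).eval x) ^ 2 := by field_simp
      nlinarith
    nlinarith
  have h9 := integralOn_derivative_sq_middle_le hh hp le_rfl hst le_rfl
  have h10 : integralOn s t (p * p) ≤ integralOn a (a + h) (p * p) :=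
    integralOn_subset (by linarith) hst (by linarith)
      fun x _ => by rw [eval_mul]; exact mul_self_nonneg _
  have h11 := integralOn_mul_self_nonneg (by linarith : a ≤ a + h) p
  rw [map_add, integralOn_C_mul, integralOn_C_mul] at h3
  have h12 : h ^ 2 / (4 * (k + 1)) * integralOn s t (derivative p * derivative p) ≤
      4 / 3 * k * integralOn a (a + h) (p * p) := by
    calc _ ≤ h ^ 2 / (4 * (k + 1)) * (16 / 3 * ((k : ℝ) * (k + 1)) / h ^ 2 *
          integralOn a (a + h) (p * p)) := by gcongr
      _ = _ := by field_simp; ring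
  rw [div_mul_eq_mul_div, le_div_iff₀ hh]
  have hk0 : (0 : ℝ) ≤ k := k.cast_nonneg
  nlinarith [mul_nonneg hk0 h11, mul_le_mul_of_nonneg_left h10 (by linarith : 0 ≤ (k : ℝ) + 2)]

end Polynomial

/-! ### The staggered pairing on one element. -/

namespace Polynomial

theorem abs_integralOn_mul_le {a b μ : ℝ} (hab : a ≤ b) (hμ : 0 < μ) (p q : ℝ[X]) :
    |integralOn a b (p * q)| ≤
      (μ * integralOn a b (p * p) + integralOn a b (q * q) / μ) / 2 := by
  have key : ∀ r : ℝ, r ^ 2 = 1 → r * integralOn a b (p * q) ≤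
      (μ * integralOn a b (p * p) + integralOn a b (q * q) / μ) / 2 := fun r hr => by
    have h1 : 0 ≤ integralOn a b ((C μ * p - C r * q) * (C μ * p - C r * q)) :=
      integralOn_mul_self_nonneg hab _
    have h2 : (C μ * p - C r * q) * (C μ * p - C r * q) =
        C (μ ^ 2) * (p * p) + C (r ^ 2) * (q * q) - C (2 * μ * r) * (p * q) := by
      simp only [C_mul, C_pow, C_ofNat]; ring
    rw [h2, map_sub, map_add, integralOn_C_mul, integralOn_C_mul, integralOn_C_mul, hr] at h1
    have h3 : μ * (integralOn a b (q * q) / μ) = integralOn a b (q * q) := by field_simp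
    refine le_of_mul_le_mul_left ?_ hμ
    nlinarith
  refine abs_le.2 ⟨?_, ?_⟩
  · have := key (-1) (by norm_num); linarith
  · have := key 1 (by norm_num); linarith

theorem abs_mul_le_of_sq_le {x y A B K M t : ℝ} (hA : 0 ≤ A) (hB : 0 ≤ B) (hK : 0 ≤ K)
    (hM : 0 ≤ M) (ht : 0 < t) (hx : x ^ 2 ≤ 8 * K / t * A) (hy : y ^ 2 ≤ 8 * M / t * B) :
    |x * y| ≤ 4 * √(K * M) / t * (A + B) := by
  refine abs_le_of_sq_le_sq ?_ (by positivity)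
  have h1 : √(K * M) ^ 2 = K * M := Real.sq_sqrt (by positivity)
  calc (x * y) ^ 2 = x ^ 2 * y ^ 2 := by ring
    _ ≤ (8 * K / t * A) * (8 * M / t * B) := by gcongr
    _ = 16 * (√(K * M) ^ 2) / t ^ 2 * (4 * A * B) := by rw [h1]; ring
    _ ≤ 16 * (√(K * M) ^ 2) / t ^ 2 * (A + B) ^ 2 := by
        gcongr; nlinarith [sq_nonneg (A - B)]
    _ = _ := by ring

/-- Holds since `8(k + 1/2)² = 8k(k + 1) + 2`. The shift by `1/2` keeps the Young weight positive
for `k = 0`, and makes the weights of both meshes add up to `4(k + m + 1)/h`. -/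
theorem sixteen_thirds_mul_le {h : ℝ} (k : ℕ) {A : ℝ} (hA : 0 ≤ A) :
    16 / 3 * ((k : ℝ) * (k + 1)) / h ^ 2 * A ≤ (4 * ((k : ℝ) + 1 / 2) / h) ^ 2 / 2 * A := by
  have : (4 * ((k : ℝ) + 1 / 2) / h) ^ 2 / 2 - 16 / 3 * ((k : ℝ) * (k + 1)) / h ^ 2 =
      (8 / 3 * ((k : ℝ) * (k + 1)) + 2) / h ^ 2 := by ring
  have h2 : 0 ≤ (8 / 3 * ((k : ℝ) * (k + 1)) + 2) / h ^ 2 := by positivity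
  exact mul_le_mul_of_nonneg_right (by linarith) hA

/-- The staggered pairing on one element: `p` lives on `[x, x + h]`, while `q₁`, `q₂` live on the
two overlapping staggered elements. -/
theorem abs_staggered_pairing_le {x h : ℝ} (hh : 0 < h) {k m : ℕ} {p q₁ q₂ : ℝ[X]}
    (hp : p.natDegree ≤ k) (hq₁ : q₁.natDegree ≤ m) (hq₂ : q₂.natDegree ≤ m) :
    |integralOn x (x + h / 2) (q₁ * derivative p)
        + integralOn (x + h / 2) (x + h) (q₂ * derivative p)
        - p.eval (x + h) * q₂.eval (x + h) + p.eval x * q₁.eval x| ≤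
      (4 * ((k : ℝ) + 1 / 2) / h + 4 * ((m : ℝ) + 1 / 2) / h
          + 16 * √(((k : ℝ) + 1) * (m + 1)) / h) / 2 *
        (integralOn x (x + h) (p * p) +
          (integralOn (x - h / 2) (x - h / 2 + h) (q₁ * q₁)
            + integralOn (x + h / 2) (x + h / 2 + h) (q₂ * q₂)) / 2) := by
  set A := integralOn x (x + h) (p * p) with hA
  set B₁ := integralOn (x - h / 2) (x - h / 2 + h) (q₁ * q₁) with hB₁
  set B₂ := integralOn (x + h / 2) (x + h / 2 + h) (q₂ * q₂) with hB₂
  set μ := 4 * ((k : ℝ) + 1 / 2) / h with hμ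
  set ν := 4 * ((m : ℝ) + 1 / 2) / h with hν
  have hμ0 : 0 < μ := by positivity
  have hν0 : 0 < ν := by positivity
  have hA0 : 0 ≤ A := integralOn_mul_self_nonneg (by linarith) _
  have hB₁0 : 0 ≤ B₁ := integralOn_mul_self_nonneg (by linarith) _
  have hB₂0 : 0 ≤ B₂ := integralOn_mul_self_nonneg (by linarith) _
  have hsq : ∀ (r : ℝ[X]) (s t : ℝ), ∀ y ∈ Icc s t, 0 ≤ (r * r).eval y := fun r s t y _ => by
    rw [eval_mul]; exact mul_self_nonneg _
  -- split the integrals at the quarter points and integrate by parts on the outer quarters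
  have s1 := integralOn_add_adjacent x (x + h / 4) (x + h / 2) (q₁ * derivative p)
  have s2 := integralOn_add_adjacent (x + h / 2) (x + 3 * h / 4) (x + h) (q₂ * derivative p)
  have d1 := integralOn_derivative x (x + h / 4) (p * q₁)
  have d2 := integralOn_derivative (x + 3 * h / 4) (x + h) (p * q₂)
  rw [derivative_mul, map_add, eval_mul, eval_mul, mul_comm (derivative p)] at d1 d2
  -- the inner quarters
  have m1 := abs_le.1 (abs_integralOn_mul_le (by linarith : x + h / 4 ≤ x + h / 2)
    (half_pos hμ0) q₁ (derivative p))
  have m2 := abs_le.1 (abs_integralOn_mul_le (by linarith : x + h / 2 ≤ x + 3 * h / 4)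
    (half_pos hμ0) q₂ (derivative p))
  have m3 := integralOn_derivative_sq_middle_le hh hp le_rfl
    (by linarith : x + h / 4 ≤ x + 3 * h / 4) le_rfl
  rw [← integralOn_add_adjacent _ (x + h / 2)] at m3
  have m4 := m3.trans (sixteen_thirds_mul_le k hA0)
  rw [← hμ] at m4
  have m5 : integralOn (x + h / 4) (x + h / 2) (q₁ * q₁) ≤ B₁ :=
    integralOn_subset (by linarith) (by linarith) (by linarith) (hsq _ _ _)
  have m6 : integralOn (x + h / 2) (x + 3 * h / 4) (q₂ * q₂) ≤ B₂ :=
    integralOn_subset (by linarith) (by linarith) (by linarith) (hsq _ _ _)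
  -- The inner quarters share one bound for `p'`, while each `qᵢ` is charged separately. The weight
  -- `μ / 2` here, and `ν` in the outer quarters, both produce the common factor `A + (B₁ + B₂)/2`.
  have m7 : integralOn (x + h / 4) (x + h / 2) (derivative p * derivative p) / (μ / 2) +
      integralOn (x + h / 2) (x + 3 * h / 4) (derivative p * derivative p) / (μ / 2) ≤ μ * A := by
    rw [← add_div, div_le_iff₀ (half_pos hμ0)]
    linarith
  -- the outer quarters
  have n1 := abs_le.1 (abs_integralOn_mul_le (by linarith : x ≤ x + h / 4)
    hν0 p (derivative q₁))
  have n2 := abs_le.1 (abs_integralOn_mul_le (by linarith : x + 3 * h / 4 ≤ x + h)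
    hν0 p (derivative q₂))
  have n3 := (integralOn_derivative_sq_middle_le hh hq₁ (a := x - h / 2) (s := x)
    (t := x + h / 4) (by linarith) (by linarith) (by linarith)).trans
      (sixteen_thirds_mul_le m hB₁0)
  have n4 := (integralOn_derivative_sq_middle_le hh hq₂ (a := x + h / 2) (s := x + 3 * h / 4)
    (t := x + h) (by linarith) (by linarith) (by linarith)).trans
      (sixteen_thirds_mul_le m hB₂0)
  rw [← hν] at n3 n4
  have n5 : integralOn x (x + h / 4) (derivative q₁ * derivative q₁) / ν ≤ ν / 2 * B₁ := by
    rw [div_le_iff₀ hν0]; linarith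
  have n6 : integralOn (x + 3 * h / 4) (x + h) (derivative q₂ * derivative q₂) / ν ≤
      ν / 2 * B₂ := by
    rw [div_le_iff₀ hν0]; linarith
  have n7 : integralOn x (x + h / 4) (p * p) + integralOn (x + 3 * h / 4) (x + h) (p * p) ≤ A := by
    rw [hA, ← integralOn_add_adjacent x (x + h / 4) (x + h),
      ← integralOn_add_adjacent (x + h / 4) (x + 3 * h / 4) (x + h)]
    have := integralOn_mul_self_nonneg (by linarith : x + h / 4 ≤ x + 3 * h / 4) p
    linarith
  have n8 := mul_le_mul_of_nonneg_left n7 hν0.le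
  -- the quarter points
  have q1 := abs_le.1 (abs_mul_le_of_sq_le hA0 hB₁0 (by positivity) (by positivity) hh
    (sq_eval_quarter_le hh hp (Or.inl rfl))
    (sq_eval_quarter_le (z := x + h / 4) hh hq₁ (Or.inr (by ring))))
  have q2 := abs_le.1 (abs_mul_le_of_sq_le hA0 hB₂0 (by positivity) (by positivity) hh
    (sq_eval_quarter_le hh hp (Or.inr rfl))
    (sq_eval_quarter_le (z := x + 3 * h / 4) hh hq₂ (Or.inl (by ring))))
  have m8 := mul_le_mul_of_nonneg_left m5 (half_pos hμ0).le
  have m9 := mul_le_mul_of_nonneg_left m6 (half_pos hμ0).le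
  -- The end values `p q₁` at `x` and `p q₂` at `x + h` cancel against the boundary terms of the
  -- integration by parts; quarter-point values replace them.
  have e : integralOn x (x + h / 2) (q₁ * derivative p)
        + integralOn (x + h / 2) (x + h) (q₂ * derivative p)
        - p.eval (x + h) * q₂.eval (x + h) + p.eval x * q₁.eval x =
      integralOn (x + h / 4) (x + h / 2) (q₁ * derivative p)
        + integralOn (x + h / 2) (x + 3 * h / 4) (q₂ * derivative p)
        - integralOn x (x + h / 4) (p * derivative q₁)
        - integralOn (x + 3 * h / 4) (x + h) (p * derivative q₂)
        + p.eval (x + h / 4) * q₁.eval (x + h / 4)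
        - p.eval (x + 3 * h / 4) * q₂.eval (x + 3 * h / 4) := by
    linarith
  rw [e]
  set R := √(((k : ℝ) + 1) * (m + 1))
  have hsum : (μ + ν + 16 * R / h) / 2 * (A + (B₁ + B₂) / 2) =
      (μ * A + μ / 2 * B₁ + μ / 2 * B₂) / 2 + (ν * A + ν / 2 * B₁ + ν / 2 * B₂) / 2
      + 4 * R / h * (A + B₁) + 4 * R / h * (A + B₂) := by ring
  rw [hsum]
  exact abs_le.2 ⟨by linarith [m1.1, m2.1, n1.2, n2.2, q1.1, q2.2],
    by linarith [m1.2, m2.2, n1.1, n2.1, q1.2, q2.1]⟩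

end Polynomial

/-! ### From one cell to the periodic mesh. -/

namespace UniformGrid

section mesh

open Polynomial

variable {g : UniformGrid} {e e' : ℤ → ℝ} {k m : ℕ} {w v φ : ℝ → ℝ}

/-- The squared `L²` norm on one element. -/
noncomputable def cellEnergy (e : ℤ → ℝ) (w : ℝ → ℝ) (j : ℤ) : ℝ :=
  ∫ x in e j..e (j + 1), w x * w x

/-- The jump `w⁻ - w⁺`. -/
noncomputable def jump (w : ℝ → ℝ) (x : ℝ) : ℝ := leftLim w x - rightLim w x

/-- One half of the staggered form on a general mesh: test function `φ` on the mesh `e`, flux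
`v - γ (w⁻ - w⁺)` at the mesh points. -/
noncomputable def halfForm (g : UniformGrid) (e : ℤ → ℝ) (γ : ℝ) (v w φ : ℝ → ℝ) : ℝ :=
  ∑ j ∈ Finset.range g.N,
    ((∫ x in e j..e (j + 1), deriv φ x * v x)
      - leftLim φ (e (j + 1)) * (v (e (j + 1)) - γ * jump w (e (j + 1)))
      + rightLim φ (e j) * (v (e j) - γ * jump w (e j)))

theorem integral_congr_of_eqOn_Ioo {a b : ℝ} (hab : a ≤ b) {f q : ℝ → ℝ}
    (h : ∀ x ∈ Ioo a b, f x = q x) :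
    ∫ x in a..b, f x = ∫ x in a..b, q x := by
  rw [intervalIntegral.integral_of_le hab, intervalIntegral.integral_of_le hab,
    integral_Ioc_eq_integral_Ioo, integral_Ioc_eq_integral_Ioo]
  exact setIntegral_congr_fun measurableSet_Ioo h

theorem mesh_succ (he : ∀ j, e j = e 0 + j * g.h) (j : ℤ) : e (j + 1) = e j + g.h := by
  rw [he j, he (j + 1)]; push_cast; ring

theorem exists_polynomial (he : ∀ j, e j = e 0 + j * g.h) (hw : w ∈ g.broken e k) (j : ℤ) :
    ∃ p : Polynomial ℝ, p.natDegree ≤ k ∧ (∀ x ∈ Ico (e j) (e j + g.h), w x = p.eval x) ∧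
      leftLim w (e j + g.h) = p.eval (e j + g.h) ∧ rightLim w (e j) = p.eval (e j) ∧
      cellEnergy e w j = integralOn (e j) (e j + g.h) (p * p) := by
  obtain ⟨p, hpd, hp⟩ := hw.2 j
  rw [mesh_succ he] at hp
  have hlt : e j < e j + g.h := lt_add_of_pos_right _ g.h_pos
  refine ⟨p, hpd, hp, leftLim_eq_of_tendsto ?_, rightLim_eq_of_tendsto ?_, ?_⟩
  · refine Tendsto.congr' ?_ (p.continuous.continuousAt.tendsto.mono_left nhdsWithin_le_nhds)
    filter_upwards [Ico_mem_nhdsLT hlt] with x hx using (hp x hx).symm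
  · refine Tendsto.congr' ?_ (p.continuous.continuousAt.tendsto.mono_left nhdsWithin_le_nhds)
    filter_upwards [Ioo_mem_nhdsGT hlt] with x hx using (hp x ⟨hx.1.le, hx.2⟩).symm
  · rw [cellEnergy, mesh_succ he]
    exact integral_congr_of_eqOn_Ioo hlt.le fun x hx => by rw [hp x ⟨hx.1.le, hx.2⟩, eval_mul]

/-- The summation mesh `d` is independent of the mesh `e` of `w`, so that shifted cells are covered:
the integral over a period does not depend on its starting point. -/
theorem sum_cellEnergy {d : ℤ → ℝ} (hd : ∀ j, d j = d 0 + j * g.h)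
    (he : ∀ j, e j = e 0 + j * g.h) (hw : w ∈ g.broken e k) :
    ∑ j ∈ Finset.range g.N, cellEnergy d w j = ∫ x in g.xL..g.xR, w x * w x := by
  have hint := integrable_of_mem he (mul_mem_broken hw hw)
  have h1 := intervalIntegral.sum_integral_adjacent_intervals (f := w * w) (μ := volume) (n := g.N)
    (a := fun k : ℕ => d k) (fun k _ => hint _ _)
  have h2 := (mul_mem_broken hw hw).1.intervalIntegral_add_eq (d 0) g.xL
  have h3 : d 0 + g.period = d g.N := by rw [hd g.N, period_eq]; simp
  rw [h3, period, add_sub_cancel] at h2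
  simp only [Nat.cast_add, Nat.cast_one, Nat.cast_zero] at h1
  exact h1.trans h2

theorem sum_cellEnergy_shift (he : ∀ j, e j = e 0 + j * g.h) (hw : w ∈ g.broken e k) (i : ℤ) :
    ∑ j ∈ Finset.range g.N, cellEnergy e w (j + i) = ∫ x in g.xL..g.xR, w x * w x := by
  rw [← sum_cellEnergy (d := fun j => e (j + i))
    (fun j => by rw [he, he (0 + i)]; push_cast; ring) he hw]
  refine Finset.sum_congr rfl fun j _ => ?_
  rw [cellEnergy, cellEnergy, add_right_comm]

theorem sq_leftLim_le (he : ∀ j, e j = e 0 + j * g.h) (hw : w ∈ g.broken e k) (j : ℤ) :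
    leftLim w (e (j + 1)) ^ 2 ≤ ((k : ℝ) + 1) ^ 2 / g.h * cellEnergy e w j := by
  obtain ⟨p, hpd, -, hl, -, hE⟩ := exists_polynomial he hw j
  have := sq_eval_right_le (lt_add_of_pos_right (e j) g.h_pos) hpd
  rwa [add_sub_cancel_left, ← hl, ← hE, ← mesh_succ he] at this

theorem sq_rightLim_le (he : ∀ j, e j = e 0 + j * g.h) (hw : w ∈ g.broken e k) (j : ℤ) :
    rightLim w (e j) ^ 2 ≤ ((k : ℝ) + 1) ^ 2 / g.h * cellEnergy e w j := by
  obtain ⟨p, hpd, -, -, hr, hE⟩ := exists_polynomial he hw j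
  have := sq_eval_left_le (lt_add_of_pos_right (e j) g.h_pos) hpd
  rwa [add_sub_cancel_left, ← hr, ← hE] at this

theorem abs_mul_jump_le (he : ∀ j, e j = e 0 + j * g.h) (hw : w ∈ g.broken e k) {y A : ℝ} (j : ℤ)
    (hy : y ^ 2 ≤ ((k : ℝ) + 1) ^ 2 / g.h * A) :
    |y * jump w (e (j + 1))| ≤ ((k : ℝ) + 1) ^ 2 / g.h / 2 *
      (2 * A + cellEnergy e w j + cellEnergy e w (j + 1)) := by
  have h1 := sq_leftLim_le he hw j
  have h2 := sq_rightLim_le he hw (j + 1)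
  unfold jump
  set a := leftLim w (e (j + 1))
  set b := rightLim w (e (j + 1))
  -- Both signs use `|y (a - b)| ≤ y² + (a - b)²/4 ≤ y² + (a² + b²)/2`.
  refine abs_le.2 ⟨?_, ?_⟩
  · nlinarith [sq_nonneg (2 * y + (a - b)), sq_nonneg (a + b)]
  · nlinarith [sq_nonneg (2 * y - (a - b)), sq_nonneg (a + b)]

theorem abs_cell_pairing_le (he : ∀ j, e j = e 0 + j * g.h) (he' : ∀ j, e' j = e j + g.h / 2)
    (hφ : φ ∈ g.broken e k) (hv : v ∈ g.broken e' m) (j : ℤ) :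
    |(∫ x in e j..e (j + 1), deriv φ x * v x) - leftLim φ (e (j + 1)) * v (e (j + 1))
        + rightLim φ (e j) * v (e j)| ≤
      (4 * ((k : ℝ) + 1 / 2) / g.h + 4 * ((m : ℝ) + 1 / 2) / g.h
          + 16 * √(((k : ℝ) + 1) * (m + 1)) / g.h) / 2 *
        (cellEnergy e φ j + (cellEnergy e' v (j + -1) + cellEnergy e' v j) / 2) := by
  have hh := g.h_pos
  have hm' : ∀ j, e' j = e' 0 + j * g.h := fun j => by rw [he', he' 0, he]; ring
  obtain ⟨p, hpd, hp, hpl, hpr, hpE⟩ := exists_polynomial he hφ j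
  obtain ⟨q₁, hq₁d, hq₁, -, -, hq₁E⟩ := exists_polynomial hm' hv (j + -1)
  obtain ⟨q₂, hq₂d, hq₂, -, -, hq₂E⟩ := exists_polynomial hm' hv j
  have e1 : e' (j + -1) = e j - g.h / 2 := by rw [he', he, he j]; push_cast; ring
  rw [e1] at hq₁ hq₁E
  rw [he'] at hq₂ hq₂E
  have hint := integrable_deriv_mul he hm' hφ hv
  -- The points of `e` are interior to the cells of `e'`, so `v` has a single polynomial value
  -- there.
  have hv1 : v (e j) = q₁.eval (e j) := hq₁ _ ⟨by linarith, by linarith⟩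
  have hv2 : v (e j + g.h) = q₂.eval (e j + g.h) := hq₂ _ ⟨by linarith, by linarith⟩
  have hder : ∀ x ∈ Ioo (e j) (e j + g.h), deriv φ x = (derivative p).eval x := fun x hx => by
    refine ((p.hasDerivAt x).congr_of_eventuallyEq ?_).deriv
    filter_upwards [Ioo_mem_nhds hx.1 hx.2] with y hy using hp y ⟨hy.1.le, hy.2⟩
  have hI := hint j
  rw [mesh_succ he] at hI
  have i1 : IntervalIntegrable (fun x => deriv φ x * v x) volume (e j) (e j + g.h / 2) :=
    hI.mono_set (by rw [uIcc_of_le (by linarith), uIcc_of_le (by linarith)]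
                    exact Icc_subset_Icc le_rfl (by linarith))
  have i2 : IntervalIntegrable (fun x => deriv φ x * v x) volume (e j + g.h / 2) (e j + g.h) :=
    hI.mono_set (by rw [uIcc_of_le (by linarith), uIcc_of_le (by linarith)]
                    exact Icc_subset_Icc (by linarith) le_rfl)
  have e2 : ∫ x in e j..e j + g.h / 2, deriv φ x * v x =
      integralOn (e j) (e j + g.h / 2) (q₁ * derivative p) :=
    integral_congr_of_eqOn_Ioo (by linarith) fun x hx => by
      rw [hder x ⟨hx.1, by linarith [hx.2]⟩, hq₁ x ⟨by linarith [hx.1], by linarith [hx.2]⟩,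
        eval_mul, mul_comm]
  have e3 : ∫ x in e j + g.h / 2..e j + g.h, deriv φ x * v x =
      integralOn (e j + g.h / 2) (e j + g.h) (q₂ * derivative p) :=
    integral_congr_of_eqOn_Ioo (by linarith) fun x hx => by
      rw [hder x ⟨by linarith [hx.1], hx.2⟩, hq₂ x ⟨by linarith [hx.1], by linarith [hx.2]⟩,
        eval_mul, mul_comm]
  rw [mesh_succ he, ← intervalIntegral.integral_add_adjacent_intervals i1 i2, e2, e3, hpl, hpr,
    hv1, hv2, hpE, hq₁E, hq₂E]
  exact abs_staggered_pairing_le hh hpd hq₁d hq₂d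

theorem abs_halfForm_le (he : ∀ j, e j = e 0 + j * g.h) (he' : ∀ j, e' j = e j + g.h / 2)
    {γ : ℝ} (hγ : 0 ≤ γ) (hφ : φ ∈ g.broken e k) (hw : w ∈ g.broken e k)
    (hv : v ∈ g.broken e' m) :
    |g.halfForm e γ v w φ| ≤
      (4 * ((k : ℝ) + 1 / 2) / g.h + 4 * ((m : ℝ) + 1 / 2) / g.h
          + 16 * √(((k : ℝ) + 1) * (m + 1)) / g.h) / 2 *
        ((∫ x in g.xL..g.xR, φ x * φ x) + ∫ x in g.xL..g.xR, v x * v x)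
      + 4 * (γ * (((k : ℝ) + 1) ^ 2 / g.h)) / 2 *
        ((∫ x in g.xL..g.xR, φ x * φ x) + ∫ x in g.xL..g.xR, w x * w x) := by
  have hm' : ∀ j, e' j = e' 0 + j * g.h := fun j => by rw [he', he' 0, he]; ring
  set M := 4 * ((k : ℝ) + 1 / 2) / g.h + 4 * ((m : ℝ) + 1 / 2) / g.h
          + 16 * √(((k : ℝ) + 1) * (m + 1)) / g.h
  set κ := ((k : ℝ) + 1) ^ 2 / g.h with hκ
  -- The jump terms at the two ends of a cell reach its neighbours. All but the last index are
  -- written as `j + i`, including `j + 0`, to match `sum_cellEnergy_shift`.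
  have hcell : ∀ j : ℤ, |(∫ x in e j..e (j + 1), deriv φ x * v x)
      - leftLim φ (e (j + 1)) * (v (e (j + 1)) - γ * jump w (e (j + 1)))
      + rightLim φ (e j) * (v (e j) - γ * jump w (e j))| ≤
      M / 2 * (cellEnergy e φ (j + 0) + (cellEnergy e' v (j + -1) + cellEnergy e' v (j + 0)) / 2)
      + γ * (κ / 2 * (4 * cellEnergy e φ (j + 0) + cellEnergy e w (j + -1)
          + 2 * cellEnergy e w (j + 0) + cellEnergy e w (j + 1))) := fun j => by
    have h1 := abs_le.1 (abs_cell_pairing_le he he' hφ hv j)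
    have h2 := abs_le.1 (abs_mul_jump_le he hw j (sq_leftLim_le he hφ j))
    have h3 := abs_mul_jump_le he hw (j + -1) (sq_rightLim_le he hφ j)
    rw [neg_add_cancel_right] at h3
    have h3 := abs_le.1 h3
    have h4 := mul_le_mul_of_nonneg_left h2.1 hγ
    have h5 := mul_le_mul_of_nonneg_left h2.2 hγ
    have h6 := mul_le_mul_of_nonneg_left h3.1 hγ
    have h7 := mul_le_mul_of_nonneg_left h3.2 hγ
    rw [add_zero]
    exact abs_le.2 ⟨by linarith [h1.1], by linarith [h1.2]⟩
  refine (Finset.abs_sum_le_sum_abs _ _).trans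
    ((Finset.sum_le_sum fun (j : ℕ) _ => hcell (j : ℤ)).trans_eq ?_)
  simp only [Finset.sum_add_distrib, ← Finset.mul_sum, ← Finset.sum_div,
    sum_cellEnergy_shift he hφ, sum_cellEnergy_shift he hw, sum_cellEnergy_shift hm' hv]
  ring

end mesh

/-! ### The operator norm. -/

/-- One factor of `c²` is absorbed into `c φ` in the first half and into `c w` in the second. This
gives the variables of the norm and the penalties `c β` and `τ / c`. -/
theorem form_eq_halfForm {g : UniformGrid} {c : ℝ} (hc : c ≠ 0) (β τ : ℝ) {k : ℕ}
    {w v φ ψ : ℝ → ℝ} (hw : w ∈ g.U k) (hφ : φ ∈ g.U k) :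
    g.form c β τ w v φ ψ = -c * (g.halfForm g.node (c * β) v (c • w) (c • φ)
      + g.halfForm g.center (τ / c) (c • w) v ψ) := by
  have hl : ∀ {u : ℝ → ℝ}, u ∈ g.U k → ∀ j, leftLim (c • u) (g.node j) = c * leftLim u (g.node j) :=
    fun hu j => leftLim_eq_of_tendsto ((tendsto_left g.node_eq hu j).const_mul c)
  have hr : ∀ {u : ℝ → ℝ}, u ∈ g.U k →
      ∀ j, rightLim (c • u) (g.node j) = c * rightLim u (g.node j) :=
    fun hu j => rightLim_eq_of_tendsto ((tendsto_right g.node_eq hu j).const_mul c)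
  have hd : ∀ x, deriv (c • φ) x = c * deriv φ x := fun x => deriv_const_mul_field c
  simp only [form, halfForm, fluxH, fluxG, jump, hl hw, hl hφ, hr hw, hr hφ, hd, mul_assoc,
    Pi.smul_apply, smul_eq_mul, mul_left_comm _ c, intervalIntegral.integral_const_mul]
  rw [mul_add, Finset.mul_sum, Finset.mul_sum, Finset.mul_sum, Finset.mul_sum, sub_eq_add_neg,
    ← Finset.sum_neg_distrib]
  congr 1
  · refine Finset.sum_congr rfl fun j _ => ?_
    ring
  · refine Finset.sum_congr rfl fun j _ => ?_
    field_simp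

theorem ip_self (g : UniformGrid) (k m : ℕ) (f : g.U k × g.V m) :
    g.ip k m f f = (∫ x in g.xL..g.xR, (f.1 : ℝ → ℝ) x * (f.1 : ℝ → ℝ) x) +
      ∫ x in g.xL..g.xR, (f.2 : ℝ → ℝ) x * (f.2 : ℝ → ℝ) x :=
  intervalIntegral.integral_add
    (integrable_of_mem g.node_eq (mul_mem_broken f.1.2 f.1.2) g.xL g.xR)
    (integrable_of_mem g.center_eq (mul_mem_broken f.2.2 f.2.2) g.xL g.xR)

theorem ip_self_nonneg (g : UniformGrid) (k m : ℕ) (f : g.U k × g.V m) : 0 ≤ g.ip k m f f := by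
  rw [ip_self]
  exact add_nonneg (intervalIntegral.integral_nonneg g.xL_lt_xR.le fun x _ => mul_self_nonneg _)
    (intervalIntegral.integral_nonneg g.xL_lt_xR.le fun x _ => mul_self_nonneg _)

/-- When the dual mesh plays the role of `e`, the mesh half a step to its right is the primal one
with index shifted by one. -/
theorem mem_broken_node_shift {g : UniformGrid} {k : ℕ} {w : ℝ → ℝ} (hw : w ∈ g.U k) :
    w ∈ g.broken (fun j => g.node (j + 1)) k :=
  ⟨hw.1, fun j => hw.2 (j + 1)⟩

/-- The bound for the norm of the spatial operator. -/
noncomputable def opBound (g : UniformGrid) (c β τ : ℝ) (k m : ℕ) : ℝ :=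
  c / g.h * (4 * ((k : ℝ) + m + 1) + 16 * √(((k : ℝ) + 1) * (m + 1))
    + 4 * max (c * β * ((k : ℝ) + 1) ^ 2) (τ / c * ((m : ℝ) + 1) ^ 2))

theorem abs_ip_spatialOp_le (g : UniformGrid) {c β τ : ℝ} (hc : 0 < c) (hβ : 0 ≤ β) (hτ : 0 ≤ τ)
    (k m : ℕ) (f z : g.U k × g.V m) :
    |g.ip k m (g.spatialOp c β τ k m f) z| ≤
      g.opBound c β τ k m / 2 * (g.ip k m f f + g.ip k m z z) := by
  have hh := g.h_pos
  obtain ⟨w, v⟩ := f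
  obtain ⟨φ, ψ⟩ := z
  obtain ⟨w, rfl⟩ : ∃ w', w = c • w' :=
    ⟨c⁻¹ • w, by rw [smul_smul, mul_inv_cancel₀ hc.ne', one_smul]⟩
  obtain ⟨φ, rfl⟩ : ∃ φ', φ = c • φ' :=
    ⟨c⁻¹ • φ, by rw [smul_smul, mul_inv_cancel₀ hc.ne', one_smul]⟩
  rw [spatialOp_spec g hc.ne', form_eq_halfForm hc.ne' β τ w.2 φ.2, ip_self, ip_self]
  have h1 := abs_halfForm_le (e := g.node) (e' := g.center) g.node_eq
    (fun j => by rw [center, mesh_succ g.node_eq]; ring) (mul_nonneg hc.le hβ)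
    (c • φ).2 (c • w).2 v.2
  have h2 := abs_halfForm_le (e := g.center) (e' := fun j => g.node (j + 1)) g.center_eq
    (fun j => by rw [center, mesh_succ g.node_eq]; ring) (div_nonneg hτ hc.le)
    ψ.2 v.2 (mem_broken_node_shift (c • w).2)
  rw [mul_comm ((m : ℝ) + 1) ((k : ℝ) + 1)] at h2
  rw [abs_mul, abs_neg, abs_of_pos hc]
  have nn : ∀ u : ℝ → ℝ, 0 ≤ ∫ x in g.xL..g.xR, u x * u x := fun u =>
    intervalIntegral.integral_nonneg g.xL_lt_xR.le fun x _ => mul_self_nonneg _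
  have n1 := nn (c • w : g.U k)
  have n2 := nn (c • φ : g.U k)
  have n3 := nn v
  have n4 := nn ψ
  simp only [Submodule.coe_smul] at h1 h2 n1 n2 ⊢
  set a := ∫ x in g.xL..g.xR, (c • (w : ℝ → ℝ)) x * (c • (w : ℝ → ℝ)) x
  set b := ∫ x in g.xL..g.xR, (c • (φ : ℝ → ℝ)) x * (c • (φ : ℝ → ℝ)) x
  set p := ∫ x in g.xL..g.xR, (v : ℝ → ℝ) x * (v : ℝ → ℝ) x
  set q := ∫ x in g.xL..g.xR, (ψ : ℝ → ℝ) x * (ψ : ℝ → ℝ) x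
  set R := √(((k : ℝ) + 1) * (m + 1))
  set M := max (c * β * ((k : ℝ) + 1) ^ 2) (τ / c * ((m : ℝ) + 1) ^ 2) with hM
  have h3 : c * β * (((k : ℝ) + 1) ^ 2 / g.h) ≤ M / g.h := by
    rw [mul_div_assoc']; exact div_le_div_of_nonneg_right (le_max_left _ _) hh.le
  have h4 : τ / c * (((m : ℝ) + 1) ^ 2 / g.h) ≤ M / g.h := by
    rw [mul_div_assoc']; exact div_le_div_of_nonneg_right (le_max_right _ _) hh.le
  have h5 := mul_le_mul_of_nonneg_right h3 (add_nonneg n2 n1)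
  have h6 := mul_le_mul_of_nonneg_right h4 (add_nonneg n4 n3)
  have h7 : g.opBound c β τ k m / 2 * (a + p + (b + q)) =
      c * ((4 * ((k : ℝ) + 1 / 2) / g.h + 4 * ((m : ℝ) + 1 / 2) / g.h + 16 * R / g.h) / 2 *
        (a + p + (b + q)) + 2 * (M / g.h * (b + a) + M / g.h * (q + p))) := by
    unfold opBound; ring
  rw [h7]
  refine mul_le_mul_of_nonneg_left ((abs_add_le _ _).trans ((add_le_add h1 h2).trans ?_)) hc.le
  linarith

theorem opBound_nonneg (g : UniformGrid) {c β τ : ℝ} (hc : 0 < c) (hβ : 0 ≤ β) (k m : ℕ) :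
    0 ≤ g.opBound c β τ k m := by
  have hh := g.h_pos
  have : 0 ≤ max (c * β * ((k : ℝ) + 1) ^ 2) (τ / c * ((m : ℝ) + 1) ^ 2) :=
    le_max_of_le_left (by positivity)
  unfold opBound
  positivity

theorem le_opBound_of_mem_quotients (g : UniformGrid) {c β τ : ℝ} (hc : 0 < c) (hβ : 0 ≤ β)
    (hτ : 0 ≤ τ) (k m : ℕ) {r : ℝ} (hr : r ∈ g.quotients c k m (g.spatialOp c β τ k m)) :
    r ≤ g.opBound c β τ k m := by
  obtain ⟨w, φ, v, ψ, hf, hz, rfl⟩ := hr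
  have hpos : ∀ (a : g.U k) (b : g.V m), (a, b) ≠ (0, 0) →
      0 < g.ip k m (c • a, b) (c • a, b) := fun a b hab => by
    refine (g.ip_self_nonneg k m _).lt_of_ne' fun h0 => hab ?_
    have h1 := Prod.ext_iff.1 (g.ip_self_eq_zero k m _ h0)
    exact Prod.ext ((smul_eq_zero.1 h1.1).resolve_left hc.ne') h1.2
  have h1 := hpos w v hf
  have h2 := hpos φ ψ hz
  generalize ((c • w, v) : g.U k × g.V m) = f at h1 ⊢
  generalize ((c • φ, ψ) : g.U k × g.V m) = z at h2 ⊢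
  -- Applied to normalized vectors, the bound `K/2 (‖f‖² + ‖z‖²)` becomes `K`.
  have key := (le_abs_self _).trans (g.abs_ip_spatialOp_le hc hβ hτ k m
    ((√(g.ip k m f f))⁻¹ • f) ((√(g.ip k m z z))⁻¹ • z))
  have hs : ∀ t : ℝ, 0 < t → (√t)⁻¹ * ((√t)⁻¹ * t) = 1 := fun t ht => by
    rw [← mul_assoc, ← mul_inv, Real.mul_self_sqrt ht.le, inv_mul_cancel₀ ht.ne']
  simp only [map_smul, LinearMap.smul_apply, smul_eq_mul, hs _ h1, hs _ h2] at key
  rw [div_eq_mul_inv, mul_inv]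
  linarith

theorem bddAbove_quotients (g : UniformGrid) {c β τ : ℝ} (hc : 0 < c) (hβ : 0 ≤ β) (hτ : 0 ≤ τ)
    (k m : ℕ) : BddAbove (g.quotients c k m (g.spatialOp c β τ k m)) :=
  ⟨_, fun _ hr => g.le_opBound_of_mem_quotients hc hβ hτ k m hr⟩

theorem opNorm_spatialOp_le (g : UniformGrid) {c β τ : ℝ} (hc : 0 < c) (hβ : 0 ≤ β) (hτ : 0 ≤ τ)
    {qu : ℕ} (hq : 1 ≤ qu) (qv : ℕ) :
    g.opNorm c (qu - 1) qv (g.spatialOp c β τ (qu - 1) qv) ≤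
      c / g.h * 4 * ((qu : ℝ) + qv - 1) + c / g.h * 20 * √((qu : ℝ) * (qv + 1))
        + c / g.h * 4 * max (c * β * (qu : ℝ) ^ 2) (τ / c * ((qv : ℝ) + 1) ^ 2) := by
  refine (Real.sSup_le (fun r hr => g.le_opBound_of_mem_quotients hc hβ hτ _ _ hr)
    (g.opBound_nonneg hc hβ _ _)).trans ?_
  obtain ⟨k, rfl⟩ : ∃ k, qu = k + 1 := ⟨qu - 1, by omega⟩
  have h1 : 0 ≤ c / g.h := div_nonneg hc.le g.h_pos.le
  -- `4(k + m + 1)` is `4(qu + qv)`, which exceeds `4(qu + qv - 1)` by `4`; the square root is at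
  -- least `1`, so it absorbs this and its coefficient grows from `16` to `20`.
  have h2 : 1 ≤ √(((k : ℝ) + 1) * (qv + 1)) :=
    Real.one_le_sqrt.2 (one_le_mul_of_one_le_of_one_le (by simp) (by simp))
  rw [Nat.add_sub_cancel, opBound]
  push_cast
  nlinarith [mul_le_mul_of_nonneg_left h2 h1]

/-- Since `1 ≤ qu`, both factors under the root are at most `qu + qv`. -/
theorem sqrt_mul_succ_le {qu : ℕ} (hq : 1 ≤ qu) (qv : ℕ) :
    √((qu : ℝ) * (qv + 1)) ≤ qu + qv := by
  have : (1 : ℝ) ≤ qu := by exact_mod_cast hq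
  have h0 : (0 : ℝ) ≤ qv := qv.cast_nonneg
  refine Real.sqrt_le_iff.2 ⟨by positivity, by nlinarith⟩

end UniformGrid

/-! ### The explicit constants and the two linear cases. -/

theorem theorem2 :
    (∃ C₃ C₄ C₅ : ℝ,
      (0 < C₃ ∧ C₃ ≤ (8 * √3 + 4) / 3) ∧
      (0 < C₄ ∧ C₄ ≤ 128 / (√3 * Real.pi)) ∧
      (0 < C₅ ∧ C₅ ≤ 4) ∧
      ∀ (g : UniformGrid) (c β τ : ℝ) (qu qv : ℕ), 0 < c → 0 ≤ β → 0 ≤ τ → 1 ≤ qu →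
        BddAbove (g.quotients c (qu - 1) qv (g.spatialOp c β τ (qu - 1) qv)) ∧
        g.opNorm c (qu - 1) qv (g.spatialOp c β τ (qu - 1) qv) ≤
          c / g.h * C₃ * ((qu : ℝ) + qv - 1) + c / g.h * C₄ * √((qu : ℝ) * (qv + 1))
            + c / g.h * C₅ * max (c * β * (qu : ℝ) ^ 2) (τ / c * ((qv : ℝ) + 1) ^ 2)) ∧
    (∃ C : ℝ, ∀ (g : UniformGrid) (c : ℝ) (qu qv : ℕ), 0 < c → 1 ≤ qu →
      g.opNorm c (qu - 1) qv (g.spatialOp c 0 0 (qu - 1) qv) ≤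
        C * (c / g.h) * ((qu : ℝ) + qv)) ∧
    (∀ βhat τhat : ℝ, 0 ≤ βhat → 0 ≤ τhat →
      ∃ C : ℝ, ∀ (g : UniformGrid) (c : ℝ) (qu qv : ℕ), 0 < c → 1 ≤ qu →
        g.opNorm c (qu - 1) qv
            (g.spatialOp c (βhat / (qu * c)) (c * τhat / (qv + 1)) (qu - 1) qv) ≤
          C * (c / g.h) * ((qu : ℝ) + qv)) := by
  have hsqrt : 1.7 ≤ √3 ∧ √3 ≤ 1.7321 :=
    ⟨Real.le_sqrt_of_sq_le (by norm_num), Real.sqrt_le_iff.2 ⟨by norm_num, by norm_num⟩⟩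
  refine ⟨⟨4, 20, 4, ⟨by norm_num, by linarith [hsqrt.1]⟩, ⟨by norm_num, ?_⟩,
    ⟨by norm_num, le_rfl⟩, fun g c β τ qu qv hc hβ hτ hq =>
      ⟨g.bddAbove_quotients hc hβ hτ _ _, g.opNorm_spatialOp_le hc hβ hτ hq qv⟩⟩,
    ⟨24, fun g c qu qv hc hq => ?_⟩, fun βhat τhat hβ hτ =>
      ⟨24 + 4 * (βhat + τhat), fun g c qu qv hc hq => ?_⟩⟩
  -- `20 · 1.7321 · 3.15 < 128`.
  · rw [le_div_iff₀ (by positivity)]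
    nlinarith [Real.pi_lt_d2, Real.pi_pos]
  · have h1 := g.opNorm_spatialOp_le hc le_rfl le_rfl hq qv
    have h2 : 0 ≤ c / g.h := div_nonneg hc.le g.h_pos.le
    simp only [mul_zero, zero_mul, zero_div, max_self, add_zero] at h1
    nlinarith [mul_le_mul_of_nonneg_left (UniformGrid.sqrt_mul_succ_le hq qv) h2]
  · have hqu : (1 : ℝ) ≤ qu := by exact_mod_cast hq
    have hqv : (0 : ℝ) ≤ qv := qv.cast_nonneg
    have h1 := g.opNorm_spatialOp_le (β := βhat / (qu * c)) (τ := c * τhat / (qv + 1)) hc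
      (by positivity) (by positivity) hq qv
    have h2 : 0 ≤ c / g.h := div_nonneg hc.le g.h_pos.le
    -- The scaling cancels one power of the degree in each penalty, leaving `βhat * qu` and `τhat *
    -- (qv + 1)`, with `qv + 1 ≤ qu + qv`.
    have h3 : max (c * (βhat / (qu * c)) * (qu : ℝ) ^ 2)
        (c * τhat / (qv + 1) / c * ((qv : ℝ) + 1) ^ 2) ≤ (βhat + τhat) * (qu + qv) := by
      refine max_le ?_ ?_
      · have : c * (βhat / (qu * c)) * (qu : ℝ) ^ 2 = βhat * qu := by field_simp
        rw [this]; nlinarith [mul_nonneg hβ hqv, mul_nonneg hτ hqv]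
      · have : c * τhat / (qv + 1) / c * ((qv : ℝ) + 1) ^ 2 = τhat * (qv + 1) := by field_simp
        rw [this]; nlinarith [mul_nonneg hβ hqv, mul_nonneg hτ hqv]
    nlinarith [mul_le_mul_of_nonneg_left (UniformGrid.sqrt_mul_succ_le hq qv) h2,
      mul_le_mul_of_nonneg_left h3 h2]
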